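/- **Setting.** An agent moves in the plane by the random waypoint model: it reaches the waypoints at the times $0, D_a, 2D_a,\dots$ with $D_a>0$, and between consecutive waypoints it moves with constant speed $v$ in a direction chosen independently and uniformly in $(0,2\pi]$. Each waypoint is polled independently with probability $p\in(0,1]$. Only polled waypoints generate an update, update $0$ being generated at waypoint $0$. Let $t_i$ be the generation time of the $i$-th update, so that the interarrival times $X_i=t_i-t_{i-1}$ are $D_a$ times independent geometric variables with parameter $p$. The updates pass through a single-server first-come-first-served queue with i.i.d. exponential service times $S_i$ of rate $\mu>0$, independent of the polling. The time spent in the system by update $0$ is $T_0\ge 0$, independent of everything else. Let $d_i$ be the departure time of update $i$ ($d_i=\max(d_{i-1},t_i)+S_i$) and $T_i=d_i-t_i$. Assume $\rho=p/(\mu D_a)<1$. For $s\le t$ let $e(s,t)$ be the mean squared displacement (expectation over the directions) of the agent between times $s$ and $t$. This is the excess of the position error bound at time $t$ over its baseline when the last available update was generated at time $s$ and the position recorded there is still used as the estimate. Let $$Q_i=\int_{t_{i-1}}^{t_i} e(t_{i-1},t)\,dt+\int_{t_i}^{d_i}\bigl(e(t_{i-1},t)-e(t_i,t)\bigr)\,dt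 ,\qquad i\ge 1,$$ be the area between the two consecutive error curves, up to the departure of update $i$. **Theorem 3.** The equation $$\beta=\frac{p\,e^{-\mu(1-\beta)D_a}}{1-(1-p)\,e^{-\mu(1-\beta)D_a}}$$ has exactly one solution $\beta\in(0,1)$. With this $\beta$, if the queue is in steady state (all $T_i$ have the same law), then every $Q_i$ is integrable and $$\mathbb E[Q_i]=\frac{v^2D_a^3}{3p}+\frac{v^2D_a^3(1-p)}{p^2}+v^2D_a^2\left[\frac{p\,e^{-\mu(1-\beta)D_a}}{\mu(1-\beta)\bigl\{1-(1-p)e^{-\mu(1-\beta)D_a}\bigr\}^2}+\frac1{\mu p}\right].$$ Moreover, from any initial $T_0$ with finite mean, every $Q_i$ is integrable and $\mathbb E[Q_i]$ converges to this value as $i\to\infty$. -/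

import Mathlib

open MeasureTheory ProbabilityTheory Filter Topology

namespace AgeOfPositioning

/-! ### Random waypoint motion and the growth of the position error bound -/

/-- The uniform distribution on `(0, 2π]`, the law of the heading chosen at a waypoint. -/
noncomputable def headingLaw : Measure ℝ :=
  ProbabilityTheory.cond volume (Set.Ioc 0 (2 * Real.pi))

/-- The joint law of the independent headings of the successive hops. -/
noncomputable def headingsLaw : Measure (ℕ → ℝ) :=
  Measure.infinitePi fun _ => headingLaw

/-- The time spent up to time `t` in the `j`-th hop, which lasts from `j * D` to `(j + 1) * D`. -/
noncomputable def hopTime (D : ℝ) (j : ℕ) (t : ℝ) : ℝ :=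
  max 0 (min D (t - j * D))

/-- The displacement at time `t ≥ 0` from the position at time `0`, for an agent that moves with
speed `v` and follows the heading `θ j` during its `j`-th hop, each hop having duration `D`. -/
noncomputable def displacement (v D : ℝ) (θ : ℕ → ℝ) (t : ℝ) : EuclideanSpace ℝ (Fin 2) :=
  ∑ j ∈ Finset.range (⌊t / D⌋₊ + 1),
    (v * hopTime D j t) • !₂[Real.cos (θ j), Real.sin (θ j)]

/-- `PEB - PEB₀` at time `t` when the last available update was generated at time `s` and the
position recorded there is still used as the estimate: the trace of the mean squared error matrix
of the position due to the motion since time `s`. -/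
noncomputable def pebGrowth (v D s t : ℝ) : ℝ :=
  ∫ θ, ‖displacement v D θ t - displacement v D θ s‖ ^ 2 ∂headingsLaw

/-! ### Updates thinned by polling, and the first come first served queue -/

variable {Ω : Type*}

/-- The index of the waypoint at which the `i`-th transmitted update is generated: update `0` is
generated at waypoint `0`, and each following update at the next polled waypoint. -/
noncomputable def genIndex (polled : ℕ → Ω → Bool) (ω : Ω) : ℕ → ℕ
  | 0 => 0
  | i + 1 => sInf {n | genIndex polled ω i < n ∧ polled n ω = true}

/-- The generation time of the `i`-th transmitted update; waypoint `n` is reached at `n * D`. -/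
noncomputable def genTime (D : ℝ) (polled : ℕ → Ω → Bool) (i : ℕ) (ω : Ω) : ℝ :=
  genIndex polled ω i * D

/-- The departure time of the `i`-th update from the single first come first served server:
service of an update starts when it has been generated and its predecessor has departed.
`T₀` is the time that update `0` spends in the system. -/
noncomputable def depTime (D : ℝ) (polled : ℕ → Ω → Bool) (service : ℕ → Ω → ℝ) (T₀ : Ω → ℝ) :
    ℕ → Ω → ℝ
  | 0, ω => genTime D polled 0 ω + T₀ ω
  | i + 1, ω =>
      max (depTime D polled service T₀ i ω) (genTime D polled (i + 1) ω) + service (i + 1) ω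

/-- The system time (waiting plus service) of the `i`-th update. -/
noncomputable def sysTime (D : ℝ) (polled : ℕ → Ω → Bool) (service : ℕ → Ω → ℝ) (T₀ : Ω → ℝ)
    (i : ℕ) (ω : Ω) : ℝ :=
  depTime D polled service T₀ i ω - genTime D polled i ω

/-- The area `Q` belonging to the consecutive updates `i` and `i + 1`: the area enclosed between
the PEB growth curve started at the generation of update `i`, followed until the departure of
update `i + 1`, and the PEB growth curve started at the generation of update `i + 1`. -/
noncomputable def areaQ (v D : ℝ) (polled : ℕ → Ω → Bool) (service : ℕ → Ω → ℝ) (T₀ : Ω → ℝ)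
    (i : ℕ) (ω : Ω) : ℝ :=
  (∫ t in (genTime D polled i ω)..(genTime D polled (i + 1) ω),
      pebGrowth v D (genTime D polled i ω) t) +
  ∫ t in (genTime D polled (i + 1) ω)..(depTime D polled service T₀ (i + 1) ω),
      (pebGrowth v D (genTime D polled i ω) t - pebGrowth v D (genTime D polled (i + 1) ω) t)

/-- The probabilistic assumptions of the queue: every waypoint is polled independently with
probability `p`, the service times are independent and exponential of rate `μ`, the initial system
time is nonnegative, and the polling decisions, the service times and the initial system time are
independent of each other. -/
structure IsPolledDM1 [MeasurableSpace Ω] (P : Measure Ω) (p μ : ℝ)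
    (polled : ℕ → Ω → Bool) (service : ℕ → Ω → ℝ) (T₀ : Ω → ℝ) : Prop where
  measurable_polled : ∀ n, Measurable (polled n)
  measurable_service : ∀ n, Measurable (service n)
  measurable_init : Measurable T₀
  prob_polled : ∀ n, P {ω | polled n ω = true} = ENNReal.ofReal p
  law_service : ∀ n, P.map (service n) = expMeasure μ
  init_nonneg : ∀ᵐ ω ∂P, 0 ≤ T₀ ω
  indep_polled : iIndepFun polled P
  indep_service : iIndepFun service P
  indep_polled_service : IndepFun (fun ω n => polled n ω) (fun ω n => service n ω) P
  indep_init : IndepFun T₀ (fun ω => ((fun n => polled n ω), (fun n => service n ω))) P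

/-- The queue is in steady state: the system times of all updates have the same law. -/
def IsSteady [MeasurableSpace Ω] (P : Measure Ω) (D : ℝ)
    (polled : ℕ → Ω → Bool) (service : ℕ → Ω → ℝ) (T₀ : Ω → ℝ) : Prop :=
  ∀ i, IdentDistrib (sysTime D polled service T₀ i) (sysTime D polled service T₀ 0) P P

/-- The equation `β = p e^{-μ(1-β)D} / (1 - (1-p) e^{-μ(1-β)D})`. -/
def IsRoot (p μ D β : ℝ) : Prop :=
  β = p * Real.exp (-μ * (1 - β) * D) / (1 - (1 - p) * Real.exp (-μ * (1 - β) * D))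

/-- The claimed value of `E[Q]`. -/
noncomputable def meanQ (v p μ D β : ℝ) : ℝ :=
  v ^ 2 * D ^ 3 / (3 * p) + v ^ 2 * D ^ 3 * (1 - p) / p ^ 2 +
    v ^ 2 * D ^ 2 *
      (p * Real.exp (-μ * (1 - β) * D) /
          (μ * (1 - β) * (1 - (1 - p) * Real.exp (-μ * (1 - β) * D)) ^ 2) +
        1 / (μ * p))

end AgeOfPositioning

/-!
The mean squared displacement since a waypoint is the sum of the squared lengths of the hops made
since then, because different headings are orthogonal on average (`integral_inner_headings`). Hence
two error curves started at waypoints `Y` hops apart stay at distance `v² D² Y`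
(`pebGrowth_sub_pebGrowth`), and, almost surely,
`Q = v² D³ (Y / 3 + Y (Y - 1) / 2) + v² D² Y T`, where `Y` is the number of hops between the two
updates and `T` the system time of the second one (`ae_areaQ_eq`).

The system times obey Lindley's recursion `T ↦ max (T - D Y) 0 + S` with `Y` geometric and
independent of the past (`measure_inter_skips`) and `S` an independent exponential service time. So
only the mean of `Y * max (T - D Y) 0` depends on the state of the queue. As the exponential law has
no memory, `Exp (μ (1 - β))` is invariant under the recursion exactly because `β` solves the root
equation (`map_sysTime_succ`), and it yields the claimed mean (`integral_succ_mul_waitFun`). The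
root exists by the intermediate value theorem and is unique by Rolle's theorem.

For the law of an arbitrary queue, a second queue with the same polling and the same services, but
an initial system time of law `Exp (μ (1 - β))`, is put on the product space `Ω × ℝ`. Since
`p < μ D`, the strong law of large numbers forces both queues to coincide eventually
(`ae_eventually_eq`), and their distance never exceeds the initial one (`ae_abs_sub_le`).
Dominated convergence then gives two things. With bounded continuous test functions, the exponential law is the only steady state
(`map_sysTime_of_isSteady`). With the Lipschitz function `meanWait`, whose dominating function is
integrable when the initial system time has a mean, the mean areas converge.
-/

namespace AgeOfPositioning

variable {Ω : Type*}

/-! ### The root equation -/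

theorem den_pos {p z : ℝ} (hp0 : 0 < p) (hz0 : 0 ≤ z) (hz1 : z < 1) :
    0 < 1 - (1 - p) * z := by nlinarith

theorem exp_neg_mul_lt_one {μ D β : ℝ} (hD : 0 < D) (hμ : 0 < μ) (hβ : β < 1) :
    Real.exp (-μ * (1 - β) * D) < 1 := by
  have := mul_pos (mul_pos hμ (sub_pos.2 hβ)) hD
  exact (Real.exp_lt_exp.2 (by linarith)).trans_eq Real.exp_zero

/-- The root equation after clearing denominators and multiplying by `exp (μ D (1 - β))`. -/
theorem isRoot_iff {p μ D β : ℝ} (hD : 0 < D) (hp0 : 0 < p) (hμ : 0 < μ)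
    (hβ : β < 1) :
    IsRoot p μ D β ↔ β * (Real.exp (μ * D * (1 - β)) - (1 - p)) = p := by
  have hz := exp_neg_mul_lt_one hD hμ hβ
  have hd := den_pos hp0 (Real.exp_pos (-μ * (1 - β) * D)).le hz
  have he : Real.exp (-μ * (1 - β) * D) * Real.exp (μ * D * (1 - β)) = 1 := by
    rw [← Real.exp_add]; ring_nf; simp
  have hpos := Real.exp_pos (-μ * (1 - β) * D)
  rw [IsRoot, eq_div_iff hd.ne']
  set z := Real.exp (-μ * (1 - β) * D)
  set w := Real.exp (μ * D * (1 - β))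
  constructor
  · intro h
    refine mul_left_cancel₀ hpos.ne' ?_
    linear_combination h + β * he
  · intro h
    linear_combination z * h - β * he

/-- Existence of the root: with `u = 1 - β`, the difference of the two sides of `isRoot_iff` is
positive for small `u > 0`, because `e^x ≥ 1 + x`, and negative at `u = 1`. -/
theorem exists_isRoot {p μ D : ℝ} (hD : 0 < D) (hp0 : 0 < p) (hμ : 0 < μ)
    (hρ : p < μ * D) : ∃ β ∈ Set.Ioo (0 : ℝ) 1, IsRoot p μ D β := by
  set a := μ * D with ha
  have ha0 : 0 < a := mul_pos hμ hD
  -- `u = 1 - β`; `u = 0` is the trivial root `β = 1`, so a sign change is sought away from it.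
  let G : ℝ → ℝ := fun u => (1 - u) * (Real.exp (a * u) - (1 - p)) - p
  have hG : Continuous G := by fun_prop
  -- Here `u₀ * (a - p - a * u₀) > 0`, which bounds `G u₀` from below.
  let u₀ : ℝ := (a - p) / (2 * a)
  have hu₀ : 0 < u₀ := div_pos (by linarith) (by linarith)
  have hau : a * u₀ = (a - p) / 2 := by simp only [u₀]; field_simp
  have hu₁ : u₀ < 1 := by
    have : a * u₀ < a * 1 := by rw [hau]; linarith
    exact lt_of_mul_lt_mul_left this ha0.le
  have hpos : 0 < G u₀ := by
    have h1 := Real.add_one_le_exp (a * u₀)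
    have h2 : (1 - u₀) * (a * u₀ + p) ≤ (1 - u₀) * (Real.exp (a * u₀) - (1 - p)) :=
      mul_le_mul_of_nonneg_left (by linarith) (by linarith)
    have h3 : (1 - u₀) * (a * u₀ + p) - p = u₀ * ((a - p) / 2) := by
      linear_combination (-u₀) * hau
    have : 0 < u₀ * ((a - p) / 2) := mul_pos hu₀ (by linarith)
    simp only [G]; linarith
  have hneg : G 1 < 0 := by simp [G, hp0]
  obtain ⟨u, hu, hGu⟩ := intermediate_value_Icc' hu₁.le hG.continuousOn
    (show (0 : ℝ) ∈ Set.Icc (G 1) (G u₀) from ⟨hneg.le, hpos.le⟩)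
  have hu1 : u ≠ 1 := by rintro rfl; exact hneg.ne hGu
  have hult : u < 1 := lt_of_le_of_ne hu.2 hu1
  refine ⟨1 - u, ⟨by linarith, by linarith [hu.1]⟩, ?_⟩
  rw [isRoot_iff hD hp0 hμ (by linarith [hu.1]), ← ha]
  simp only [G] at hGu
  rw [sub_sub_cancel]
  linarith

/-- Uniqueness of the root: two zeros `0 < u₁ < u₂`, besides the one at `0`, of
`u ↦ a u + log (1 - u) - log (1 - (1 - p) u)` would give two zeros of its strictly monotone
derivative. -/
theorem isRoot_unique_of_lt {p μ D β₁ β₂ : ℝ} (hD : 0 < D) (hp0 : 0 < p) (hp1 : p ≤ 1)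
    (hμ : 0 < μ) (h₁ : IsRoot p μ D β₁) (h₂ : IsRoot p μ D β₂) (h0 : 0 < β₁) (h12 : β₁ < β₂)
    (h21 : β₂ < 1) : False := by
  rw [isRoot_iff hD hp0 hμ (by linarith)] at h₁ h₂
  set a := μ * D
  let k : ℝ → ℝ := fun u => a * u + Real.log (1 - u) - Real.log (1 - (1 - p) * u)
  -- `u = 1 - β` is a root if and only if `k u = 0`, and `k 0 = 0`.
  have hc : ∀ u : ℝ, 0 ≤ u → u < 1 → 0 < 1 - (1 - p) * u := fun u => den_pos hp0
  have hk : ∀ u : ℝ, 0 ≤ u → u < 1 →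
      HasDerivAt k (a - p / ((1 - u) * (1 - (1 - p) * u))) u := by
    intro u hu0 hu1
    have e1 := ((hasDerivAt_id u).const_sub 1).log (sub_pos.2 hu1).ne'
    have e2 := (((hasDerivAt_id u).const_mul (1 - p)).const_sub 1).log (hc u hu0 hu1).ne'
    have e3 := (((hasDerivAt_id u).const_mul a).add e1).sub e2
    refine e3.congr_deriv ?_
    have n1 := (sub_pos.2 hu1).ne'
    have n2 := (hc u hu0 hu1).ne'
    simp only [id]
    rw [mul_one, mul_one, add_sub_assoc, div_sub_div _ _ n1 n2, sub_eq_add_neg a, ← neg_div]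
    congr 2
    ring
  have hk0 : k 0 = 0 := by simp [k]
  have hroot : ∀ β : ℝ, 0 < β → β < 1 → β * (Real.exp (a * (1 - β)) - (1 - p)) = p →
      k (1 - β) = 0 := by
    intro β hb0 hb1 h
    have h' : β * Real.exp (a * (1 - β)) = 1 - (1 - p) * (1 - β) := by linarith
    have := congrArg Real.log h'
    rw [Real.log_mul hb0.ne' (Real.exp_pos _).ne', Real.log_exp] at this
    simp only [k, sub_sub_cancel]
    linarith
  have r1 := hroot β₁ h0 (by linarith) h₁
  have r2 := hroot β₂ (by linarith) h21 h₂
  have cont : ∀ x y : ℝ, 0 ≤ x → y < 1 → ContinuousOn k (Set.Icc x y) := fun x y hx hy u hu =>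
    (hk u (hx.trans hu.1) (hu.2.trans_lt hy)).continuousAt.continuousWithinAt
  obtain ⟨ξ, hξ, e1⟩ := exists_hasDerivAt_eq_zero (f := k) (sub_pos.2 h21)
    (cont _ _ le_rfl (by linarith)) (hk0.trans r2.symm)
    (fun u hu => hk u hu.1.le (by linarith [hu.2]))
  obtain ⟨η, hη, e2⟩ := exists_hasDerivAt_eq_zero (f := k) (show 1 - β₂ < 1 - β₁ by linarith)
    (cont _ _ (by linarith) (by linarith)) (r2.trans r1.symm)
    (fun u hu => hk u (by linarith [hu.1]) (by linarith [hu.2]))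
  have hlt : ξ < η := hξ.2.trans hη.1
  have hη1 : η < 1 := by linarith [hη.2]
  have c1 := hc ξ hξ.1.le (by linarith)
  have c2 := hc η (by linarith [hξ.1]) hη1
  have : p / ((1 - ξ) * (1 - (1 - p) * ξ)) < p / ((1 - η) * (1 - (1 - p) * η)) := by
    refine div_lt_div_of_pos_left hp0 (mul_pos (by linarith) c2) ?_
    have : 1 - (1 - p) * η ≤ 1 - (1 - p) * ξ := by nlinarith
    nlinarith
  linarith

theorem existsUnique_isRoot {p μ D : ℝ} (hD : 0 < D) (hp0 : 0 < p) (hp1 : p ≤ 1) (hμ : 0 < μ)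
    (hρ : p < μ * D) : ∃! β : ℝ, β ∈ Set.Ioo (0 : ℝ) 1 ∧ IsRoot p μ D β := by
  obtain ⟨β, hβ, h⟩ := exists_isRoot hD hp0 hμ hρ
  refine ⟨β, ⟨hβ, h⟩, fun γ hγ => ?_⟩
  rcases lt_trichotomy γ β with hlt | rfl | hlt
  · exact (isRoot_unique_of_lt hD hp0 hp1 hμ hγ.2 h hγ.1.1 hlt hβ.2).elim
  · rfl
  · exact (isRoot_unique_of_lt hD hp0 hp1 hμ h hγ.2 hβ.1 hlt hγ.1.2).elim

/-! ### Mean squared displacement -/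

instance isProbabilityMeasure_headingLaw : IsProbabilityMeasure headingLaw := by
  apply ProbabilityTheory.cond_isProbabilityMeasure_of_finite
  · simp [Real.volume_Ioc, Real.pi_pos]
  · rw [Real.volume_Ioc]; exact ENNReal.ofReal_ne_top

instance isProbabilityMeasure_headingsLaw : IsProbabilityMeasure headingsLaw := by
  unfold headingsLaw; infer_instance

theorem integral_headingLaw_eq (f : ℝ → ℝ) :
    ∫ x, f x ∂headingLaw = (2 * Real.pi)⁻¹ * ∫ x in (0 : ℝ)..(2 * Real.pi), f x := by
  rw [headingLaw, ProbabilityTheory.cond, integral_smul_measure,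
    intervalIntegral.integral_of_le Real.two_pi_pos.le, Real.volume_Ioc, sub_zero,
    ENNReal.toReal_inv, ENNReal.toReal_ofReal Real.two_pi_pos.le, smul_eq_mul]

theorem integral_cos_headingLaw : ∫ x, Real.cos x ∂headingLaw = 0 := by
  simp [integral_headingLaw_eq]

theorem integral_sin_headingLaw : ∫ x, Real.sin x ∂headingLaw = 0 := by
  simp [integral_headingLaw_eq]

/-- The headings of two different hops are orthogonal on average. -/
theorem integral_inner_headings {i j : ℕ} (hij : i ≠ j) :
    ∫ θ, (Real.cos (θ i) * Real.cos (θ j) + Real.sin (θ i) * Real.sin (θ j)) ∂headingsLaw = 0 := by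
  have hprod : ∀ f : ℝ → ℝ, Measurable f → ∫ x, f x ∂headingLaw = 0 →
      ∫ θ, f (θ i) * f (θ j) ∂headingsLaw = 0 := by
    intro f hf h0
    have hind : iIndepFun (fun (i : ℕ) (θ : ℕ → ℝ) => f (θ i)) headingsLaw :=
      iIndepFun_infinitePi (P := fun _ : ℕ => headingLaw) (X := fun _ => f) (fun _ => hf)
    have hz : ∀ n : ℕ, ∫ θ, f (θ n) ∂headingsLaw = 0 := by
      intro n
      have := integral_map (μ := headingsLaw) (φ := fun θ : ℕ → ℝ => θ n) (f := f)
        (measurable_pi_apply n).aemeasurable hf.aestronglyMeasurable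
      rw [headingsLaw] at this ⊢
      rw [← this, Measure.infinitePi_map_eval, h0]
    rw [(hind.indepFun hij).integral_fun_mul_eq_mul_integral
      (hf.comp (measurable_pi_apply i)).aestronglyMeasurable
      (hf.comp (measurable_pi_apply j)).aestronglyMeasurable, hz, zero_mul]
  have hint : ∀ f : ℝ → ℝ, Measurable f → (∀ x, |f x| ≤ 1) →
      Integrable (fun θ : ℕ → ℝ => f (θ i) * f (θ j)) headingsLaw := by
    intro f hf h1
    refine Integrable.of_bound (by fun_prop) 1 (ae_of_all _ fun θ => ?_)
    rw [Real.norm_eq_abs, abs_mul]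
    exact mul_le_one₀ (h1 _) (abs_nonneg _) (h1 _)
  rw [integral_add (hint _ Real.measurable_cos Real.abs_cos_le_one)
    (hint _ Real.measurable_sin Real.abs_sin_le_one),
    hprod _ Real.measurable_cos integral_cos_headingLaw,
    hprod _ Real.measurable_sin integral_sin_headingLaw, add_zero]

theorem norm_sq_sum_headings (c : ℕ → ℝ) (s : Finset ℕ) (θ : ℕ → ℝ) :
    ‖∑ j ∈ s, c j • (!₂[Real.cos (θ j), Real.sin (θ j)] : EuclideanSpace ℝ (Fin 2))‖ ^ 2 =
      ∑ i ∈ s, ∑ j ∈ s,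
        c i * c j * (Real.cos (θ i) * Real.cos (θ j) + Real.sin (θ i) * Real.sin (θ j)) := by
  rw [EuclideanSpace.norm_sq_eq]
  simp only [Fin.sum_univ_two, Real.norm_eq_abs, sq_abs, WithLp.ofLp_sum,
    Finset.sum_apply, WithLp.ofLp_smul, Pi.smul_apply, smul_eq_mul, Matrix.cons_val_zero,
    Matrix.cons_val_one]
  rw [sq, sq, Finset.sum_mul_sum, Finset.sum_mul_sum, ← Finset.sum_add_distrib]
  refine Finset.sum_congr rfl fun i _ => ?_
  rw [← Finset.sum_add_distrib]
  refine Finset.sum_congr rfl fun j _ => ?_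
  ring

theorem integral_norm_sq_sum_headings (c : ℕ → ℝ) (s : Finset ℕ) :
    ∫ θ, ‖∑ j ∈ s, c j • (!₂[Real.cos (θ j), Real.sin (θ j)] : EuclideanSpace ℝ (Fin 2))‖ ^ 2
      ∂headingsLaw = ∑ j ∈ s, c j ^ 2 := by
  have hint : ∀ i j : ℕ, Integrable (fun θ : ℕ → ℝ => c i * c j *
      (Real.cos (θ i) * Real.cos (θ j) + Real.sin (θ i) * Real.sin (θ j))) headingsLaw := by
    intro i j
    refine Integrable.const_mul (Integrable.of_bound (by fun_prop) 1 (ae_of_all _ fun θ => ?_)) _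
    rw [← Real.cos_sub]
    exact Real.abs_cos_le_one _
  simp_rw [norm_sq_sum_headings]
  rw [integral_finsetSum _ fun i _ => integrable_finsetSum _ fun j _ => hint i j]
  refine Finset.sum_congr rfl fun i hi => ?_
  rw [integral_finsetSum _ fun j _ => hint i j, Finset.sum_eq_single i]
  · have : ∀ θ : ℕ → ℝ, Real.cos (θ i) * Real.cos (θ i) + Real.sin (θ i) * Real.sin (θ i) = 1 :=
      fun θ => by rw [← sq, ← sq]; exact Real.cos_sq_add_sin_sq _
    simp [this, sq]
  · intro j _ hj
    rw [integral_const_mul, integral_inner_headings hj.symm, mul_zero]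
  · exact fun h => (h hi).elim

theorem hopTime_of_le {D : ℝ} {j : ℕ} {t : ℝ} (h : t ≤ j * D) : hopTime D j t = 0 :=
  max_eq_left ((min_le_right _ _).trans (by linarith))

theorem hopTime_of_ge {D : ℝ} (hD : 0 < D) {j : ℕ} {t : ℝ} (h : (j + 1) * D ≤ t) :
    hopTime D j t = D := by
  rw [hopTime, min_eq_left (by linarith), max_eq_right hD.le]

theorem hopTime_of_mem {D : ℝ} {j : ℕ} {t : ℝ} (h : j * D ≤ t) (h' : t ≤ (j + 1) * D) :
    hopTime D j t = t - j * D := by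
  rw [hopTime, min_eq_right (by linarith), max_eq_right (by linarith)]

theorem continuous_hopTime (D : ℝ) (j : ℕ) : Continuous (hopTime D j) := by
  unfold hopTime; fun_prop

/-- Hops that have not begun by time `t` contribute nothing, so the sum may be lengthened. -/
theorem displacement_eq_sum {v D : ℝ} (hD : 0 < D) (θ : ℕ → ℝ) {t : ℝ} {n : ℕ}
    (hn : t ≤ n * D) :
    displacement v D θ t = ∑ j ∈ Finset.range n,
      (v * hopTime D j t) • (!₂[Real.cos (θ j), Real.sin (θ j)] : EuclideanSpace ℝ (Fin 2)) := by
  have key : ∀ m : ℕ, t ≤ m * D → ∀ N, m ≤ N → ∑ j ∈ Finset.range m,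
      (v * hopTime D j t) • (!₂[Real.cos (θ j), Real.sin (θ j)] : EuclideanSpace ℝ (Fin 2)) =
      ∑ j ∈ Finset.range N, (v * hopTime D j t) • !₂[Real.cos (θ j), Real.sin (θ j)] := by
    intro m hm N hN
    refine Finset.sum_subset (Finset.range_mono hN) fun j _ hj => ?_
    have hmj : (m : ℝ) ≤ j := by exact_mod_cast not_lt.1 (fun h => hj (Finset.mem_range.2 h))
    rw [hopTime_of_le (hm.trans (mul_le_mul_of_nonneg_right hmj hD.le)), mul_zero, zero_smul]
  have hfl : t ≤ ((⌊t / D⌋₊ + 1 : ℕ) : ℝ) * D := by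
    rw [← div_le_iff₀ hD]
    push_cast
    exact (Nat.lt_floor_add_one _).le
  rw [displacement, key _ hfl _ (le_max_left _ n), ← key _ hn _ (le_max_right _ _)]

/-- Between a waypoint and a later time, only the hops after that waypoint contribute. -/
theorem pebGrowth_eq_sum {v D : ℝ} (hD : 0 < D) {k n : ℕ} {t : ℝ} (hk : k * D ≤ t)
    (hn : t ≤ n * D) :
    pebGrowth v D (k * D) t = v ^ 2 * ∑ j ∈ Finset.Ico k n, hopTime D j t ^ 2 := by
  have hkn : k ≤ n := by exact_mod_cast le_of_mul_le_mul_right (hk.trans hn) hD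
  have hdiff : ∀ θ : ℕ → ℝ, displacement v D θ t - displacement v D θ (k * D) =
      ∑ j ∈ Finset.Ico k n,
        (v * hopTime D j t) • (!₂[Real.cos (θ j), Real.sin (θ j)] : EuclideanSpace ℝ (Fin 2)) := by
    intro θ
    rw [displacement_eq_sum hD θ hn, displacement_eq_sum hD θ le_rfl,
      ← Finset.sum_range_add_sum_Ico _ hkn, sub_eq_iff_eq_add, add_comm]
    congr 1
    refine Finset.sum_congr rfl fun j hj => ?_
    have hjk : ((j : ℝ) + 1) * D ≤ k * D :=
      mul_le_mul_of_nonneg_right (by exact_mod_cast Finset.mem_range.1 hj) hD.le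
    rw [hopTime_of_ge hD hjk, hopTime_of_ge hD (hjk.trans hk)]
  simp_rw [pebGrowth, hdiff]
  rw [integral_norm_sq_sum_headings (fun j => v * hopTime D j t), Finset.mul_sum]
  simp_rw [mul_pow]

theorem integral_hopTime_sq {D : ℝ} (hD : 0 < D) {k j n : ℕ} (hkj : k ≤ j) (hjn : j < n) :
    ∫ t in (k * D)..(n * D), hopTime D j t ^ 2 = D ^ 3 / 3 + D ^ 3 * ((n : ℝ) - j - 1) := by
  have hii : ∀ a b : ℝ, IntervalIntegrable (fun t => hopTime D j t ^ 2) volume a b :=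
    fun a b => ((continuous_hopTime D j).pow 2).intervalIntegrable _ _
  have h1 : (k : ℝ) * D ≤ j * D := mul_le_mul_of_nonneg_right (by exact_mod_cast hkj) hD.le
  have h2 : (j : ℝ) * D ≤ (j + 1) * D := by nlinarith
  have h3 : ((j : ℝ) + 1) * D ≤ n * D :=
    mul_le_mul_of_nonneg_right (by exact_mod_cast hjn) hD.le
  have e1 : ∫ t in (k * D)..(j * D), hopTime D j t ^ 2 = 0 := by
    rw [intervalIntegral.integral_congr (g := fun _ => (0 : ℝ)) (fun t ht => ?_)]
    · simp
    · rw [Set.uIcc_of_le h1] at ht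
      simp [hopTime_of_le ht.2]
  have e2 : ∫ t in (j * D)..((j + 1) * D), hopTime D j t ^ 2 = D ^ 3 / 3 := by
    rw [intervalIntegral.integral_congr (g := fun t => (t - j * D) ^ 2) (fun t ht => ?_)]
    · rw [intervalIntegral.integral_comp_sub_right (fun t => t ^ 2), integral_pow]
      ring
    · rw [Set.uIcc_of_le h2] at ht
      simp [hopTime_of_mem ht.1 ht.2]
  have e3 : ∫ t in ((j + 1) * D)..(n * D), hopTime D j t ^ 2 = D ^ 3 * ((n : ℝ) - j - 1) := by
    rw [intervalIntegral.integral_congr (g := fun _ => D ^ 2) (fun t ht => ?_)]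
    · rw [intervalIntegral.integral_const, smul_eq_mul]; ring
    · rw [Set.uIcc_of_le h3] at ht
      simp [hopTime_of_ge hD ht.1]
  rw [← intervalIntegral.integral_add_adjacent_intervals (hii _ _) (hii ((j + 1) * D) _),
    ← intervalIntegral.integral_add_adjacent_intervals (hii _ _) (hii (j * D) _), e1, e2, e3,
    zero_add]

theorem integral_pebGrowth {v D : ℝ} (hD : 0 < D) (k y : ℕ) :
    ∫ t in (k * D)..((k + y : ℕ) * D), pebGrowth v D (k * D) t =
      v ^ 2 * D ^ 3 * (y / 3 + y * (y - 1) / 2) := by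
  have hle : (k : ℝ) * D ≤ (k + y : ℕ) * D :=
    mul_le_mul_of_nonneg_right (by push_cast; linarith [Nat.cast_nonneg (α := ℝ) y]) hD.le
  rw [intervalIntegral.integral_congr
    (g := fun t => v ^ 2 * ∑ j ∈ Finset.Ico k (k + y), hopTime D j t ^ 2) (fun t ht => by
      rw [Set.uIcc_of_le hle] at ht
      exact pebGrowth_eq_sum hD ht.1 ht.2),
    intervalIntegral.integral_const_mul,
    intervalIntegral.integral_finsetSum (f := fun j t => hopTime D j t ^ 2) fun j _ =>
      ((continuous_hopTime D j).pow 2).intervalIntegrable _ _,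
    Finset.sum_congr rfl fun j hj => integral_hopTime_sq hD (Finset.mem_Ico.1 hj).1
      (Finset.mem_Ico.1 hj).2, mul_assoc]
  congr 1
  rw [Finset.sum_Ico_eq_sum_range, Nat.add_sub_cancel_left]
  have : ∀ m : ℕ, ∀ a : ℝ, ∑ i ∈ Finset.range m,
      (D ^ 3 / 3 + D ^ 3 * (a - i - 1)) = D ^ 3 * (m / 3 + m * (a - 1) - m * (m - 1) / 2) := by
    intro m a
    induction m with
    | zero => simp
    | succ m ih => rw [Finset.sum_range_succ, ih]; push_cast; ring
  rw [Finset.sum_congr rfl fun i _ => show D ^ 3 / 3 + D ^ 3 * (((k + y : ℕ) : ℝ) - (k + i : ℕ) - 1)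
    = D ^ 3 / 3 + D ^ 3 * ((y : ℝ) - i - 1) by push_cast; ring, this]
  ring

/-- Once the second curve has started, the two growth curves stay at constant distance. -/
theorem pebGrowth_sub_pebGrowth {v D : ℝ} (hD : 0 < D) (k y : ℕ) {t : ℝ}
    (ht : (k + y : ℕ) * D ≤ t) :
    pebGrowth v D (k * D) t - pebGrowth v D ((k + y : ℕ) * D) t = v ^ 2 * D ^ 2 * y := by
  obtain ⟨n, hn⟩ := exists_nat_ge (t / D)
  rw [div_le_iff₀ hD] at hn
  have hle : (k : ℝ) * D ≤ (k + y : ℕ) * D :=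
    mul_le_mul_of_nonneg_right (by push_cast; linarith [Nat.cast_nonneg (α := ℝ) y]) hD.le
  have hkn : k + y ≤ n := by exact_mod_cast le_of_mul_le_mul_right (ht.trans hn) hD
  rw [pebGrowth_eq_sum hD (hle.trans ht) hn, pebGrowth_eq_sum hD ht hn, ← mul_sub,
    ← Finset.sum_Ico_consecutive _ (Nat.le_add_right k y) hkn, add_sub_cancel_right, mul_assoc]
  congr 1
  rw [Finset.sum_congr rfl (g := fun _ => D ^ 2) fun j hj => ?_]
  · simp [mul_comm]
  · rw [hopTime_of_ge hD (le_trans (mul_le_mul_of_nonneg_right ?_ hD.le) ht)]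
    exact_mod_cast (Finset.mem_Ico.1 hj).2

theorem integral_pebGrowth_sub {v D : ℝ} (hD : 0 < D) (k y : ℕ) {d : ℝ}
    (hd : (k + y : ℕ) * D ≤ d) :
    ∫ t in ((k + y : ℕ) * D)..d, (pebGrowth v D (k * D) t - pebGrowth v D ((k + y : ℕ) * D) t) =
      v ^ 2 * D ^ 2 * (y * (d - (k + y : ℕ) * D)) := by
  rw [intervalIntegral.integral_congr (g := fun _ => v ^ 2 * D ^ 2 * y) (fun t ht => by
    rw [Set.uIcc_of_le hd] at ht
    exact pebGrowth_sub_pebGrowth hD k y ht.1), intervalIntegral.integral_const, smul_eq_mul]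
  ring

/-! ### Independence of countably many sources -/

/-- Two mutually independent families whose joint `σ`-algebras are independent form one mutually
independent family. -/
theorem iIndep_sumElim {ι κ : Type*} [mΩ : MeasurableSpace Ω] {P : Measure Ω}
    {m₁ : ι → MeasurableSpace Ω} {m₂ : κ → MeasurableSpace Ω} (h₁ : iIndep m₁ P)
    (h₂ : iIndep m₂ P) (h : Indep (⨆ i, m₁ i) (⨆ i, m₂ i) P) : iIndep (Sum.elim m₁ m₂) P := by
  rw [iIndep_iff]
  intro s f hf
  have hl : ∀ i ∈ s.toLeft, MeasurableSet[m₁ i] (f (Sum.inl i)) :=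
    fun i hi => hf _ (Finset.mem_toLeft.1 hi)
  have hr : ∀ i ∈ s.toRight, MeasurableSet[m₂ i] (f (Sum.inr i)) :=
    fun i hi => hf _ (Finset.mem_toRight.1 hi)
  have hset : ⋂ i ∈ s, f i =
      (⋂ i ∈ s.toLeft, f (Sum.inl i)) ∩ ⋂ i ∈ s.toRight, f (Sum.inr i) := by
    ext ω
    simp [Set.mem_iInter]
  rw [hset, (Indep_iff _ _ _).1 h _ _ (Finset.measurableSet_biInter _ fun i hi =>
      le_iSup m₁ i _ (hl i hi)) (Finset.measurableSet_biInter _ fun i hi =>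
      le_iSup m₂ i _ (hr i hi)), (iIndep_iff _ _).1 h₁ _ hl, (iIndep_iff _ _).1 h₂ _ hr,
    ← Finset.prod_disjSum s.toLeft s.toRight fun i => P (f i), Finset.toLeft_disjSum_toRight]

theorem comap_comp_le {β γ : Type*} [MeasurableSpace β] [MeasurableSpace γ] {g : β → γ}
    (hg : Measurable g) (F : Ω → β) :
    MeasurableSpace.comap (fun ω => g (F ω)) inferInstance ≤
      MeasurableSpace.comap F inferInstance :=
  measurable_iff_comap_le.1 (hg.comp (comap_measurable F))

theorem measurable_sInf_nat [MeasurableSpace Ω] {S : Ω → Set ℕ}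
    (h : ∀ n, MeasurableSet {ω | n ∈ S ω}) : Measurable fun ω => sInf (S ω) := by
  refine measurable_to_countable' fun n => ?_
  have : (fun ω => sInf (S ω)) ⁻¹' {n} =
      ({ω | n ∈ S ω} ∩ ⋂ k ∈ Set.Iio n, {ω | k ∈ S ω}ᶜ) ∪
        ({_ω | n = 0} ∩ ⋂ k, {ω | k ∈ S ω}ᶜ) := by
    ext ω
    simp only [Set.mem_preimage, Set.mem_singleton_iff, Set.mem_union, Set.mem_inter_iff,
      Set.mem_ofPred_eq, Set.mem_iInter, Set.mem_Iio, Set.mem_compl_iff]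
    constructor
    · rintro rfl
      rcases (S ω).eq_empty_or_nonempty with h0 | h0
      · exact Or.inr ⟨by simp [h0], by simp [h0]⟩
      · exact Or.inl ⟨Nat.sInf_mem h0, fun k hk => Nat.notMem_of_lt_sInf hk⟩
    · rintro (⟨h1, h2⟩ | ⟨rfl, h2⟩)
      · exact le_antisymm (Nat.sInf_le h1)
          (not_lt.1 fun hlt => h2 _ hlt (Nat.sInf_mem ⟨n, h1⟩))
      · simp [Set.eq_empty_of_forall_notMem h2]
  rw [this]
  exact ((h n).inter (MeasurableSet.biInter (Set.to_countable _) fun k _ => (h k).compl)).union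
    ((MeasurableSet.const _).inter (MeasurableSet.iInter fun k => (h k).compl))

/-! ### Measurability of the queue -/

theorem measurable_genIndex [MeasurableSpace Ω] {polled : ℕ → Ω → Bool}
    (h : ∀ n, Measurable (polled n)) (i : ℕ) : Measurable fun ω => genIndex polled ω i := by
  induction i with
  | zero => exact measurable_const
  | succ i ih =>
    exact measurable_sInf_nat (S := fun ω => {n | genIndex polled ω i < n ∧ polled n ω = true})
      fun n => (ih (measurableSet_Iio (a := n))).inter (h n (measurableSet_singleton true))

theorem measurable_genTime [MeasurableSpace Ω] (D : ℝ) {polled : ℕ → Ω → Bool}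
    (h : ∀ n, Measurable (polled n)) (i : ℕ) : Measurable (genTime D polled i) :=
  ((measurable_from_top (f := fun n : ℕ => (n : ℝ))).comp (measurable_genIndex h i)).mul_const D

theorem measurable_depTime [MeasurableSpace Ω] (D : ℝ) {polled : ℕ → Ω → Bool}
    {service : ℕ → Ω → ℝ} {T₀ : Ω → ℝ} (h : ∀ n, Measurable (polled n))
    (hs : ∀ n, Measurable (service n)) (h0 : Measurable T₀) (i : ℕ) :
    Measurable (depTime D polled service T₀ i) := by
  induction i with
  | zero => exact (measurable_genTime D h 0).add h0
  | succ i ih => exact (ih.max (measurable_genTime D h (i + 1))).add (hs (i + 1))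

theorem measurable_sysTime [MeasurableSpace Ω] (D : ℝ) {polled : ℕ → Ω → Bool}
    {service : ℕ → Ω → ℝ} {T₀ : Ω → ℝ} (h : ∀ n, Measurable (polled n))
    (hs : ∀ n, Measurable (service n)) (h0 : Measurable T₀) (i : ℕ) :
    Measurable (sysTime D polled service T₀ i) :=
  (measurable_depTime D h hs h0 i).sub (measurable_genTime D h i)

/-- The number of waypoints skipped between the `i`-th update and the next one; the interarrival
time is `(skips i + 1) * D`. -/
noncomputable def skips (polled : ℕ → Ω → Bool) (i : ℕ) (ω : Ω) : ℕ :=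
  genIndex polled ω (i + 1) - genIndex polled ω i - 1

theorem measurable_skips [MeasurableSpace Ω] {polled : ℕ → Ω → Bool}
    (h : ∀ n, Measurable (polled n)) (i : ℕ) : Measurable (skips polled i) :=
  (measurable_from_top (f := fun n : ℕ => n - 1)).comp
    ((measurable_genIndex h (i + 1)).sub (measurable_genIndex h i))

/-! ### Waiting for the next polled waypoint -/

/-- Infinitely many waypoints are polled, so that no update index is a junk value. -/
def PollsForever (polled : ℕ → Ω → Bool) (ω : Ω) : Prop :=
  ∀ m, ∃ n, m < n ∧ polled n ω = true

theorem PollsForever.genIndex_succ_mem {polled : ℕ → Ω → Bool} {ω : Ω}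
    (h : PollsForever polled ω) (i : ℕ) :
    genIndex polled ω i < genIndex polled ω (i + 1) ∧
      polled (genIndex polled ω (i + 1)) ω = true :=
  Nat.sInf_mem (s := {n | genIndex polled ω i < n ∧ polled n ω = true}) (h _)

theorem PollsForever.genIndex_mono {polled : ℕ → Ω → Bool} {ω : Ω}
    (h : PollsForever polled ω) : Monotone (genIndex polled ω) :=
  monotone_nat_of_le_succ fun i => (h.genIndex_succ_mem i).1.le

theorem PollsForever.genIndex_succ {polled : ℕ → Ω → Bool} {ω : Ω}
    (h : PollsForever polled ω) (i : ℕ) :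
    genIndex polled ω (i + 1) = genIndex polled ω i + (skips polled i ω + 1) := by
  have := (h.genIndex_succ_mem i).1
  unfold skips
  omega

theorem genIndex_succ_eq {polled : ℕ → Ω → Bool} {ω : Ω} {i m : ℕ}
    (h1 : genIndex polled ω i < m) (h2 : polled m ω = true)
    (h3 : ∀ n, genIndex polled ω i < n → n < m → polled n ω = false) :
    genIndex polled ω (i + 1) = m := by
  refine le_antisymm (Nat.sInf_le ⟨h1, h2⟩) (le_csInf ⟨m, h1, h2⟩ fun n hn => ?_)
  by_contra hlt
  simp [h3 n hn.1 (not_le.1 hlt)] at hn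

theorem not_polled_of_lt_genIndex_succ {polled : ℕ → Ω → Bool} {ω : Ω} {i n : ℕ}
    (h1 : genIndex polled ω i < n) (h2 : n < genIndex polled ω (i + 1)) :
    polled n ω = false := by
  by_contra h
  exact Nat.notMem_of_lt_sInf (s := {n | genIndex polled ω i < n ∧ polled n ω = true}) h2
    ⟨h1, by simpa using h⟩

theorem PollsForever.skips_eq_iff {polled : ℕ → Ω → Bool} {ω : Ω}
    (h : PollsForever polled ω) {i m : ℕ} (hm : genIndex polled ω i = m) (k : ℕ) :
    skips polled i ω = k ↔
      (∀ j < k, polled (m + 1 + j) ω = false) ∧ polled (m + 1 + k) ω = true := by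
  have hs := h.genIndex_succ i
  constructor
  · rintro rfl
    refine ⟨fun j hj => not_polled_of_lt_genIndex_succ (i := i) (by omega) (by omega), ?_⟩
    have := (h.genIndex_succ_mem i).2
    rw [hs, hm] at this
    convert this using 2
    omega
  · rintro ⟨h1, h2⟩
    have := genIndex_succ_eq (i := i) (by omega) h2 fun n hn hn' => by
      obtain ⟨j, rfl⟩ := Nat.exists_eq_add_of_le (show m + 1 ≤ n by omega)
      exact h1 j (by omega)
    omega

/-- The index of an update is determined by the polling decisions up to that index. -/
theorem PollsForever.genIndex_congr {polled polled' : ℕ → Ω → Bool} {ω : Ω}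
    (h : PollsForever polled ω) {m : ℕ} (hm : ∀ n ≤ m, polled n ω = polled' n ω) (i : ℕ)
    (hi : genIndex polled ω i ≤ m) : genIndex polled' ω i = genIndex polled ω i := by
  induction i with
  | zero => rfl
  | succ i ih =>
    have h1 := h.genIndex_succ_mem i
    have ih' := ih (h1.1.le.trans hi)
    refine genIndex_succ_eq (ih' ▸ h1.1) (hm _ hi ▸ h1.2) fun n hn hn' => ?_
    rw [← hm n (hn'.le.trans hi)]
    exact not_polled_of_lt_genIndex_succ (ih' ▸ hn) hn'

/-- The polling decisions up to waypoint `m`, continued by polling every waypoint. The continuation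
makes all update indices genuine while using no information from after waypoint `m`. -/
def truncPolled (polled : ℕ → Ω → Bool) (m n : ℕ) (ω : Ω) : Bool :=
  if n ≤ m then polled n ω else true

theorem pollsForever_truncPolled (polled : ℕ → Ω → Bool) (m : ℕ) (ω : Ω) :
    PollsForever (truncPolled polled m) ω := fun k =>
  ⟨max k m + 1, by omega, by rw [truncPolled, if_neg (by omega)]⟩

theorem truncPolled_of_le (polled : ℕ → Ω → Bool) {m n : ℕ} (h : n ≤ m) (ω : Ω) :
    truncPolled polled m n ω = polled n ω := if_pos h

theorem PollsForever.genIndex_truncPolled {polled : ℕ → Ω → Bool} {ω : Ω}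
    (h : PollsForever polled ω) {m i : ℕ} (hi : genIndex polled ω i ≤ m) :
    genIndex (truncPolled polled m) ω i = genIndex polled ω i :=
  h.genIndex_congr (fun _ hn => (truncPolled_of_le polled hn ω).symm) i hi

theorem PollsForever.genIndex_truncPolled_eq_iff {polled : ℕ → Ω → Bool} {ω : Ω}
    (h : PollsForever polled ω) (m i : ℕ) :
    genIndex (truncPolled polled m) ω i = m ↔ genIndex polled ω i = m := by
  constructor
  · intro hm
    rw [(pollsForever_truncPolled polled m ω).genIndex_congr
      (fun n hn => truncPolled_of_le polled hn ω) i hm.le, hm]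
  · intro hm
    rw [h.genIndex_truncPolled hm.le, hm]

theorem depTime_congr {D : ℝ} {polled polled' : ℕ → Ω → Bool} {service service' : ℕ → Ω → ℝ}
    {T₀ : Ω → ℝ} {ω : Ω} {i : ℕ} (hg : ∀ j ≤ i, genIndex polled' ω j = genIndex polled ω j)
    (hs : ∀ j ≤ i, service' j ω = service j ω) :
    depTime D polled' service' T₀ i ω = depTime D polled service T₀ i ω := by
  induction i with
  | zero => rfl
  | succ i ih =>
    rw [depTime, depTime, ih (fun j hj => hg j (by omega)) (fun j hj => hs j (by omega)), genTime,
      genTime, hg _ le_rfl, hs _ le_rfl]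

theorem sysTime_congr {D : ℝ} {polled polled' : ℕ → Ω → Bool} {service service' : ℕ → Ω → ℝ}
    {T₀ : Ω → ℝ} {ω : Ω} {i : ℕ} (hg : ∀ j ≤ i, genIndex polled' ω j = genIndex polled ω j)
    (hs : ∀ j ≤ i, service' j ω = service j ω) :
    sysTime D polled' service' T₀ i ω = sysTime D polled service T₀ i ω := by
  rw [sysTime, sysTime, depTime_congr hg hs, genTime, genTime, hg _ le_rfl]

/-- The Lindley recursion of the system times. -/
theorem PollsForever.sysTime_succ {polled : ℕ → Ω → Bool} {ω : Ω} (h : PollsForever polled ω)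
    (D : ℝ) (service : ℕ → Ω → ℝ) (T₀ : Ω → ℝ) (i : ℕ) :
    sysTime D polled service T₀ (i + 1) ω =
      max (sysTime D polled service T₀ i ω - (skips polled i ω + 1) * D) 0 +
        service (i + 1) ω := by
  have : genTime D polled (i + 1) ω = genTime D polled i ω + (skips polled i ω + 1) * D := by
    rw [genTime, genTime, h.genIndex_succ i]; push_cast; ring
  rw [sysTime, depTime, add_sub_right_comm, ← max_sub_sub_right, sub_self, sysTime, this]
  congr 2
  ring

/-! ### The independence structure -/

/-- The `σ`-algebras generated by the initial system time, by the single polling decisions and by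
the single service times. -/
@[reducible] def sources (polled : ℕ → Ω → Bool) (service : ℕ → Ω → ℝ) (T₀ : Ω → ℝ) :
    Unit ⊕ (ℕ ⊕ ℕ) → MeasurableSpace Ω :=
  Sum.elim (fun _ => MeasurableSpace.comap T₀ inferInstance)
    (Sum.elim (fun n => MeasurableSpace.comap (polled n) inferInstance)
      (fun n => MeasurableSpace.comap (service n) inferInstance))

/-- The information carried by the sources whose labels lie in `A`. -/
@[reducible] def sourceAlgebra (polled : ℕ → Ω → Bool) (service : ℕ → Ω → ℝ) (T₀ : Ω → ℝ)
    (A : Set (Unit ⊕ (ℕ ⊕ ℕ))) : MeasurableSpace Ω :=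
  ⨆ a ∈ A, sources polled service T₀ a

section sources

variable {polled : ℕ → Ω → Bool} {service : ℕ → Ω → ℝ} {T₀ : Ω → ℝ}
  {A : Set (Unit ⊕ (ℕ ⊕ ℕ))}

theorem measurable_init_sourceAlgebra (h : Sum.inl () ∈ A) :
    Measurable[sourceAlgebra polled service T₀ A] T₀ :=
  measurable_iff_comap_le.2 (le_iSup₂_of_le (f := fun a (_ : a ∈ A) => sources polled service T₀ a)
    (Sum.inl ()) h le_rfl)

theorem measurable_polled_sourceAlgebra {n : ℕ} (h : Sum.inr (Sum.inl n) ∈ A) :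
    Measurable[sourceAlgebra polled service T₀ A] (polled n) :=
  measurable_iff_comap_le.2 (le_iSup₂_of_le (f := fun a (_ : a ∈ A) => sources polled service T₀ a)
    (Sum.inr (Sum.inl n)) h le_rfl)

theorem measurable_service_sourceAlgebra {n : ℕ} (h : Sum.inr (Sum.inr n) ∈ A) :
    Measurable[sourceAlgebra polled service T₀ A] (service n) :=
  measurable_iff_comap_le.2 (le_iSup₂_of_le (f := fun a (_ : a ∈ A) => sources polled service T₀ a)
    (Sum.inr (Sum.inr n)) h le_rfl)

end sources

namespace IsPolledDM1

variable [mΩ : MeasurableSpace Ω] {P : Measure Ω} {p μ : ℝ} {polled : ℕ → Ω → Bool}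
  {service : ℕ → Ω → ℝ} {T₀ : Ω → ℝ}

theorem sources_le (h : IsPolledDM1 P p μ polled service T₀) (a : Unit ⊕ (ℕ ⊕ ℕ)) :
    sources polled service T₀ a ≤ mΩ := by
  rcases a with a | n | n
  · exact h.measurable_init.comap_le
  · exact (h.measurable_polled n).comap_le
  · exact (h.measurable_service n).comap_le

theorem iIndep_sources [IsProbabilityMeasure P] (h : IsPolledDM1 P p μ polled service T₀) :
    iIndep (sources polled service T₀) P := by
  refine iIndep_sumElim (iIndep.of_subsingleton) (iIndep_sumElim h.indep_polled.iIndep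
    h.indep_service.iIndep ?_) ?_
  · refine indep_of_indep_of_le (IndepFun_iff_Indep _ _ _ |>.1 h.indep_polled_service)
      (iSup_le fun n => ?_) (iSup_le fun n => ?_)
    · exact comap_comp_le (measurable_pi_apply n) fun ω n => polled n ω
    · exact comap_comp_le (measurable_pi_apply n) fun ω n => service n ω
  · refine indep_of_indep_of_le (IndepFun_iff_Indep _ _ _ |>.1 h.indep_init)
      (iSup_le fun n => le_rfl) (iSup_le ?_)
    rintro (n | n)
    · exact comap_comp_le ((measurable_pi_apply n).comp measurable_fst)
        fun ω => ((fun n => polled n ω), (fun n => service n ω))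
    · exact comap_comp_le ((measurable_pi_apply n).comp measurable_snd)
        fun ω => ((fun n => polled n ω), (fun n => service n ω))

theorem indep_sourceAlgebra [IsProbabilityMeasure P] (h : IsPolledDM1 P p μ polled service T₀)
    {A B : Set (Unit ⊕ (ℕ ⊕ ℕ))} (hAB : Disjoint A B) :
    Indep (sourceAlgebra polled service T₀ A) (sourceAlgebra polled service T₀ B) P :=
  indep_iSup_of_disjoint h.sources_le h.iIndep_sources hAB

theorem ae_pollsForever [IsProbabilityMeasure P] (h : IsPolledDM1 P p μ polled service T₀)
    (hp0 : 0 < p) : ∀ᵐ ω ∂P, PollsForever polled ω := by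
  have hm : ∀ n, MeasurableSet {ω | polled n ω = true} :=
    fun n => h.measurable_polled n (measurableSet_singleton true)
  have hi : iIndepSet (fun n => {ω | polled n ω = true}) P :=
    (iIndepSet_iff_meas_biInter hm).2 fun s => h.indep_polled.meas_biInter fun n _ =>
      ⟨{true}, measurableSet_singleton true, rfl⟩
  have := measure_limsup_eq_one hm hi (by
    simp_rw [h.prob_polled]
    exact ENNReal.tsum_const_eq_top_of_ne_zero (by simpa using hp0))
  filter_upwards [(prob_compl_eq_zero_iff (MeasurableSet.measurableSet_limsup hm)).2 this]
    with ω hω m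
  have hω' : ω ∈ limsup (fun n => {ω | polled n ω = true}) atTop := by
    simpa using hω
  rw [mem_limsup_iff_frequently_mem, frequently_atTop'] at hω'
  exact hω' m

/-- The probability that after waypoint `m` exactly `k` waypoints are skipped. -/
theorem measure_skip [IsProbabilityMeasure P] (h : IsPolledDM1 P p μ polled service T₀)
    (hp0 : 0 < p) (hp1 : p ≤ 1) (m k : ℕ) :
    P {ω | (∀ j < k, polled (m + 1 + j) ω = false) ∧ polled (m + 1 + k) ω = true} =
      ENNReal.ofReal ((1 - p) ^ k * p) := by
  have hF : ∀ n, P {ω | polled n ω = false} = ENNReal.ofReal (1 - p) := by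
    intro n
    have hc : {ω | polled n ω = false} = {ω | polled n ω = true}ᶜ := by ext; simp
    rw [hc, prob_compl_eq_one_sub (show MeasurableSet {ω | polled n ω = true} from
        h.measurable_polled n (measurableSet_singleton true)),
      h.prob_polled, ENNReal.ofReal_sub _ hp0.le, ENNReal.ofReal_one]
  have hind : iIndepFun (fun j => polled (m + 1 + j)) P :=
    h.indep_polled.precomp (g := fun j => m + 1 + j) fun a b hab => by simpa using hab
  let f : ℕ → Set Ω := fun j =>
    if j < k then {ω | polled (m + 1 + j) ω = false} else {ω | polled (m + 1 + j) ω = true}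
  have hset : {ω | (∀ j < k, polled (m + 1 + j) ω = false) ∧ polled (m + 1 + k) ω = true} =
      ⋂ j ∈ Finset.range (k + 1), f j := by
    ext ω
    simp only [Set.mem_ofPred_eq, Set.mem_iInter, Finset.mem_range, f]
    constructor
    · rintro ⟨h1, h2⟩ j hj
      by_cases hjk : j < k
      · rw [if_pos hjk]; exact h1 j hjk
      · obtain rfl : j = k := by omega
        rw [if_neg hjk]; exact h2
    · intro h0
      refine ⟨fun j hj => ?_, ?_⟩
      · have := h0 j (by omega); rwa [if_pos hj] at this
      · have := h0 k (by omega); rwa [if_neg (lt_irrefl k)] at this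
  rw [hset, hind.meas_biInter fun j _ => ?_, Finset.prod_range_succ]
  · rw [Finset.prod_congr rfl (g := fun _ => ENNReal.ofReal (1 - p)) fun j hj => ?_,
      Finset.prod_const, Finset.card_range, ENNReal.ofReal_mul (by
        exact pow_nonneg (by linarith) _), ENNReal.ofReal_pow (by linarith)]
    · simp only [f, if_neg (lt_irrefl k), h.prob_polled]
    · simp only [f, if_pos (Finset.mem_range.1 hj), hF]
  · by_cases hjk : j < k
    · simp only [f, if_pos hjk]; exact ⟨{false}, measurableSet_singleton _, rfl⟩
    · simp only [f, if_neg hjk]; exact ⟨{true}, measurableSet_singleton _, rfl⟩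

end IsPolledDM1

/-! ### Law and independence of the interarrival times -/

/-- The labels of the polling decisions taken after waypoint `m`. -/
def futureLabels (m : ℕ) : Set (Unit ⊕ (ℕ ⊕ ℕ)) :=
  Set.range fun k => Sum.inr (Sum.inl (m + 1 + k))

theorem polled_label_notMem_futureLabels {n m : ℕ} (h : n ≤ m) :
    (Sum.inr (Sum.inl n) : Unit ⊕ (ℕ ⊕ ℕ)) ∉ futureLabels m := by
  rintro ⟨k, hk⟩
  simp at hk
  omega

theorem service_label_notMem_futureLabels (n m : ℕ) :
    (Sum.inr (Sum.inr n) : Unit ⊕ (ℕ ⊕ ℕ)) ∉ futureLabels m := by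
  rintro ⟨k, hk⟩
  simp at hk

theorem init_label_notMem_futureLabels (m : ℕ) :
    (Sum.inl () : Unit ⊕ (ℕ ⊕ ℕ)) ∉ futureLabels m := by
  rintro ⟨k, hk⟩
  simp at hk

theorem measure_eq_tsum_inter_preimage [MeasurableSpace Ω] {P : Measure Ω} {G : Ω → ℕ}
    (hG : Measurable G) {A : Set Ω} (hA : MeasurableSet A) :
    P A = ∑' m, P (A ∩ G ⁻¹' {m}) := by
  rw [← measure_iUnion _ fun m => hA.inter (hG (measurableSet_singleton m)),
    ← Set.inter_iUnion, ← Set.preimage_iUnion, Set.iUnion_of_singleton, Set.preimage_univ,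
    Set.inter_univ]
  · intro m n hmn
    exact ((Set.disjoint_singleton.2 hmn).preimage G).mono Set.inter_subset_right
      Set.inter_subset_right

theorem measurable_truncPolled_past {polled : ℕ → Ω → Bool} {service : ℕ → Ω → ℝ}
    {T₀ : Ω → ℝ} (m n : ℕ) :
    Measurable[sourceAlgebra polled service T₀ (futureLabels m)ᶜ] (truncPolled polled m n) := by
  by_cases h : n ≤ m
  · have : truncPolled polled m n = polled n := funext fun ω => truncPolled_of_le polled h ω
    rw [this]
    exact measurable_polled_sourceAlgebra (polled_label_notMem_futureLabels h)
  · have : truncPolled polled m n = fun _ => true := funext fun ω => if_neg h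
    rw [this]
    exact measurable_const

/-- The success probability as a point of the unit interval. -/
noncomputable def successProb {p : ℝ} (hp0 : 0 < p) (hp1 : p ≤ 1) : unitInterval :=
  ⟨p, hp0.le, hp1⟩

theorem successProb_ne_zero {p : ℝ} (hp0 : 0 < p) (hp1 : p ≤ 1) :
    successProb hp0 hp1 ≠ 0 := fun h => hp0.ne' (congrArg Subtype.val h)

namespace IsPolledDM1

variable [mΩ : MeasurableSpace Ω] {P : Measure Ω} {p μ : ℝ} {polled : ℕ → Ω → Bool}
  {service : ℕ → Ω → ℝ} {T₀ : Ω → ℝ} {E : Type*} [MeasurableSpace E]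

/-- The number of waypoints skipped after update `i` is geometric, independently of everything
that is determined by the sources other than the polling decisions after that update: on the event
that update `i` is generated at waypoint `m`, the value of `X` and the next interarrival time depend
on complementary sources. -/
theorem measure_inter_skips [IsProbabilityMeasure P]
    (h : IsPolledDM1 P p μ polled service T₀) (hp0 : 0 < p) (hp1 : p ≤ 1) {i : ℕ} {X : Ω → E}
    (hX : Measurable X)
    (hdet : ∀ m, ∃ X' : Ω → E,
      Measurable[sourceAlgebra polled service T₀ (futureLabels m)ᶜ] X' ∧
        ∀ᵐ ω ∂P, genIndex polled ω i = m → X ω = X' ω)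
    {B : Set E} (hB : MeasurableSet B) (k : ℕ) :
    P (X ⁻¹' B ∩ skips polled i ⁻¹' {k}) = P (X ⁻¹' B) * ENNReal.ofReal ((1 - p) ^ k * p) := by
  have hG := measurable_genIndex h.measurable_polled i
  have hK := measurable_skips h.measurable_polled i
  rw [measure_eq_tsum_inter_preimage hG ((hX hB).inter (hK (measurableSet_singleton k))),
    measure_eq_tsum_inter_preimage hG (hX hB), ← ENNReal.tsum_mul_right]
  refine tsum_congr fun m => ?_
  obtain ⟨X', hX', heq⟩ := hdet m
  let U : Set Ω := X' ⁻¹' B ∩ (fun ω => genIndex (truncPolled polled m) ω i) ⁻¹' {m}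
  let F : Set Ω :=
    {ω | (∀ j < k, polled (m + 1 + j) ω = false) ∧ polled (m + 1 + k) ω = true}
  have hU : MeasurableSet[sourceAlgebra polled service T₀ (futureLabels m)ᶜ] U :=
    (hX' hB).inter
      ((@measurable_genIndex Ω (sourceAlgebra polled service T₀ (futureLabels m)ᶜ) _
        (fun n => measurable_truncPolled_past m n) i) (measurableSet_singleton m))
  have hF : MeasurableSet[sourceAlgebra polled service T₀ (futureLabels m)] F := by
    have hm : ∀ j, Measurable[sourceAlgebra polled service T₀ (futureLabels m)]
        (polled (m + 1 + j)) := fun j => measurable_polled_sourceAlgebra ⟨j, rfl⟩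
    have : F = (⋂ j ∈ Set.Iio k, polled (m + 1 + j) ⁻¹' {false}) ∩
        polled (m + 1 + k) ⁻¹' {true} := by
      ext ω; simp [F]
    rw [this]
    exact (MeasurableSet.biInter (Set.to_countable _) fun j _ =>
      hm j (measurableSet_singleton false)).inter (hm k (measurableSet_singleton true))
  have e1 : (X ⁻¹' B ∩ skips polled i ⁻¹' {k} ∩ (fun ω => genIndex polled ω i) ⁻¹' {m} : Set Ω)
      =ᵐ[P] (U ∩ F : Set Ω) := by
    filter_upwards [heq, h.ae_pollsForever hp0] with ω h1 h2
    apply propext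
    change (X ω ∈ B ∧ skips polled i ω = k) ∧ genIndex polled ω i = m ↔
      (X' ω ∈ B ∧ genIndex (truncPolled polled m) ω i = m) ∧
        (∀ j < k, polled (m + 1 + j) ω = false) ∧ polled (m + 1 + k) ω = true
    rw [h2.genIndex_truncPolled_eq_iff]
    constructor
    · rintro ⟨⟨a, b⟩, c⟩
      exact ⟨⟨h1 c ▸ a, c⟩, (h2.skips_eq_iff c k).1 b⟩
    · rintro ⟨⟨a, c⟩, b⟩
      exact ⟨⟨(h1 c).symm ▸ a, (h2.skips_eq_iff c k).2 b⟩, c⟩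
  have e2 : (X ⁻¹' B ∩ (fun ω => genIndex polled ω i) ⁻¹' {m} : Set Ω) =ᵐ[P] U := by
    filter_upwards [heq, h.ae_pollsForever hp0] with ω h1 h2
    apply propext
    change X ω ∈ B ∧ genIndex polled ω i = m ↔
      X' ω ∈ B ∧ genIndex (truncPolled polled m) ω i = m
    rw [h2.genIndex_truncPolled_eq_iff]
    exact and_congr_left fun c => by rw [h1 c]
  rw [measure_congr e1, measure_congr e2,
    (Indep_iff _ _ _).1 (h.indep_sourceAlgebra disjoint_compl_left) U F hU hF,
    h.measure_skip hp0 hp1]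

theorem map_skips [IsProbabilityMeasure P] (h : IsPolledDM1 P p μ polled service T₀)
    (hp0 : 0 < p) (hp1 : p ≤ 1) (i : ℕ) :
    P.map (skips polled i) = geometricMeasure (successProb hp0 hp1) := by
  refine Measure.ext_of_singleton fun k => ?_
  rw [Measure.map_apply (measurable_skips h.measurable_polled i) (measurableSet_singleton k),
    geometricMeasure_singleton (successProb_ne_zero hp0 hp1)]
  have := h.measure_inter_skips hp0 hp1 (i := i) (X := fun _ => ()) measurable_const
    (fun m => ⟨fun _ => (), measurable_const, ae_of_all _ fun _ _ => rfl⟩) MeasurableSet.univ k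
  simpa [successProb] using this

theorem indepFun_skips_of_determined [IsProbabilityMeasure P]
    (h : IsPolledDM1 P p μ polled service T₀) (hp0 : 0 < p) (hp1 : p ≤ 1) {i : ℕ} {X : Ω → E}
    (hX : Measurable X)
    (hdet : ∀ m, ∃ X' : Ω → E,
      Measurable[sourceAlgebra polled service T₀ (futureLabels m)ᶜ] X' ∧
        ∀ᵐ ω ∂P, genIndex polled ω i = m → X ω = X' ω) :
    IndepFun X (skips polled i) P := by
  have hK := measurable_skips h.measurable_polled i
  rw [indepFun_iff_measure_inter_preimage_eq_mul]
  intro B t hB ht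
  have : (P.restrict (X ⁻¹' B)).map (skips polled i) =
      P (X ⁻¹' B) • P.map (skips polled i) := by
    refine Measure.ext_of_singleton fun k => ?_
    rw [Measure.map_apply hK (measurableSet_singleton k),
      Measure.restrict_apply (hK (measurableSet_singleton k)), Set.inter_comm,
      h.measure_inter_skips hp0 hp1 hX hdet hB, Measure.smul_apply, h.map_skips hp0 hp1,
      geometricMeasure_singleton (successProb_ne_zero hp0 hp1), smul_eq_mul]
    rfl
  have := congrArg (fun ν => ν t) this
  simp only [Measure.smul_apply, smul_eq_mul] at this
  rwa [Measure.map_apply hK ht, Measure.restrict_apply (hK ht), Set.inter_comm,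
    Measure.map_apply hK ht] at this

/-- On the event that update `i` is generated at waypoint `m`, its system time can be computed from
the polling decisions truncated at `m`. -/
theorem indepFun_sysTime_skips [IsProbabilityMeasure P]
    (h : IsPolledDM1 P p μ polled service T₀) (hp0 : 0 < p) (hp1 : p ≤ 1) (D : ℝ) (i : ℕ) :
    IndepFun (sysTime D polled service T₀ i) (skips polled i) P := by
  refine h.indepFun_skips_of_determined hp0 hp1
    (measurable_sysTime D h.measurable_polled h.measurable_service h.measurable_init i)
    fun m => ⟨sysTime D (truncPolled polled m) service T₀ i, ?_, ?_⟩
  · exact @measurable_sysTime Ω (sourceAlgebra polled service T₀ (futureLabels m)ᶜ) D _ _ _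
      (fun n => measurable_truncPolled_past m n)
      (fun n => measurable_service_sourceAlgebra (service_label_notMem_futureLabels n m))
      (measurable_init_sourceAlgebra (init_label_notMem_futureLabels m)) i
  · filter_upwards [h.ae_pollsForever hp0] with ω hω hm
    exact (sysTime_congr (fun j hj =>
      hω.genIndex_truncPolled ((hω.genIndex_mono hj).trans hm.le)) fun _ _ => rfl).symm

theorem indepFun_skips [IsProbabilityMeasure P]
    (h : IsPolledDM1 P p μ polled service T₀) (hp0 : 0 < p) (hp1 : p ≤ 1) {j i : ℕ}
    (hji : j < i) : IndepFun (skips polled j) (skips polled i) P := by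
  refine h.indepFun_skips_of_determined hp0 hp1 (measurable_skips h.measurable_polled j)
    fun m => ⟨skips (truncPolled polled m) j, ?_, ?_⟩
  · exact @measurable_skips Ω (sourceAlgebra polled service T₀ (futureLabels m)ᶜ) _
      (fun n => measurable_truncPolled_past m n) j
  · filter_upwards [h.ae_pollsForever hp0] with ω hω hm
    rw [skips, skips, hω.genIndex_truncPolled ((hω.genIndex_mono hji).trans hm.le),
      hω.genIndex_truncPolled ((hω.genIndex_mono hji.le).trans hm.le)]

/-- A service time is independent of the state of the queue when it starts. -/
theorem indepFun_state_service [IsProbabilityMeasure P]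
    (h : IsPolledDM1 P p μ polled service T₀) (D : ℝ) (i : ℕ) :
    IndepFun (fun ω => (sysTime D polled service T₀ i ω, skips polled i ω)) (service (i + 1)) P := by
  let A : Set (Unit ⊕ (ℕ ⊕ ℕ)) := {Sum.inr (Sum.inr (i + 1))}
  have hpol : ∀ n, Measurable[sourceAlgebra polled service T₀ Aᶜ] (polled n) := fun n =>
    measurable_polled_sourceAlgebra (by simp [A])
  have hinit : Measurable[sourceAlgebra polled service T₀ Aᶜ] T₀ :=
    measurable_init_sourceAlgebra (by simp [A])
  -- The `i`-th system time does not change when the later services are replaced by `0`.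
  let service' : ℕ → Ω → ℝ := fun n => if n ≤ i then service n else fun _ => 0
  have hser : ∀ n, Measurable[sourceAlgebra polled service T₀ Aᶜ] (service' n) := by
    intro n
    by_cases hn : n ≤ i
    · simp only [service', if_pos hn]
      exact measurable_service_sourceAlgebra (by simp [A]; omega)
    · simp only [service', if_neg hn]
      exact measurable_const
  have hT : Measurable[sourceAlgebra polled service T₀ Aᶜ] (sysTime D polled service T₀ i) := by
    have : sysTime D polled service T₀ i = sysTime D polled service' T₀ i := funext fun ω =>
      sysTime_congr (fun _ _ => rfl) fun j hj => by simp only [service', if_pos hj]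
    rw [this]
    exact @measurable_sysTime Ω (sourceAlgebra polled service T₀ Aᶜ) D _ _ _ hpol hser hinit i
  rw [IndepFun_iff_Indep]
  refine indep_of_indep_of_le (h.indep_sourceAlgebra (A := Aᶜ) (B := A) disjoint_compl_left) ?_ ?_
  · exact measurable_iff_comap_le.1
      (hT.prodMk (@measurable_skips Ω (sourceAlgebra polled service T₀ Aᶜ) _ hpol i))
  · exact measurable_iff_comap_le.1 (measurable_service_sourceAlgebra (by simp [A]))

theorem indepFun_skips_service [IsProbabilityMeasure P]
    (h : IsPolledDM1 P p μ polled service T₀) (i : ℕ) :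
    IndepFun (skips polled i) (service (i + 1)) P :=
  (h.indepFun_state_service 0 i).comp measurable_snd measurable_id

end IsPolledDM1

/-! ### Passing to a product space -/

theorem iIndepFun_comp_fst [MeasurableSpace Ω] {P : Measure Ω} [IsProbabilityMeasure P]
    {Ω' : Type*} [MeasurableSpace Ω'] {ν : Measure Ω'} [IsProbabilityMeasure ν] {ι : Type*}
    {E : ι → Type*} [∀ i, MeasurableSpace (E i)] {f : (i : ι) → Ω → E i} (hf : iIndepFun f P)
    (hm : ∀ i, Measurable (f i)) : iIndepFun (fun i (z : Ω × Ω') => f i z.1) (P.prod ν) := by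
  have key : ∀ A : Set Ω, MeasurableSet A → (P.prod ν) (Prod.fst ⁻¹' A) = P A := fun A hA =>
    measurePreserving_fst.measure_preimage hA.nullMeasurableSet
  rw [iIndepFun_iff_measure_inter_preimage_eq_mul] at hf ⊢
  intro S sets hS
  have hprod : ∏ i ∈ S, (P.prod ν) ((fun z : Ω × Ω' => f i z.1) ⁻¹' sets i) =
      ∏ i ∈ S, P (f i ⁻¹' sets i) :=
    Finset.prod_congr rfl fun i hi => key (f i ⁻¹' sets i) (hm i (hS i hi))
  rw [hprod, ← hf S hS, ← key _
    (Finset.measurableSet_biInter _ fun i hi => hm i (hS i hi)), Set.preimage_iInter₂]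
  rfl

theorem indepFun_comp_fst [MeasurableSpace Ω] {P : Measure Ω} [IsProbabilityMeasure P]
    {Ω' : Type*} [MeasurableSpace Ω'] {ν : Measure Ω'} [IsProbabilityMeasure ν]
    {E F : Type*} [MeasurableSpace E] [MeasurableSpace F] {f : Ω → E} {g : Ω → F}
    (h : IndepFun f g P) (hf : Measurable f) (hg : Measurable g) :
    IndepFun (fun z : Ω × Ω' => f z.1) (fun z => g z.1) (P.prod ν) := by
  have key : ∀ A : Set Ω, MeasurableSet A → (P.prod ν) (Prod.fst ⁻¹' A) = P A := fun A hA =>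
    measurePreserving_fst.measure_preimage hA.nullMeasurableSet
  rw [indepFun_iff_measure_inter_preimage_eq_mul] at h ⊢
  intro s t hs ht
  have := h s t hs ht
  rwa [← key _ (hf hs), ← key _ (hg ht), ← key _ ((hf hs).inter (hg ht))] at this

namespace IsPolledDM1

variable [mΩ : MeasurableSpace Ω] {P : Measure Ω} {p μ : ℝ} {polled : ℕ → Ω → Bool}
  {service : ℕ → Ω → ℝ} {T₀ : Ω → ℝ}

/-- The queue on a product space: polling and service are read off from the first coordinate, the
initial system time is any function of one coordinate. -/
theorem prod [IsProbabilityMeasure P] (h : IsPolledDM1 P p μ polled service T₀)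
    {ν : Measure ℝ} [IsProbabilityMeasure ν] {T : Ω × ℝ → ℝ} (hT : Measurable T)
    (hT0 : ∀ᵐ z ∂P.prod ν, 0 ≤ T z)
    (hind : IndepFun T (fun z => ((fun n => polled n z.1), (fun n => service n z.1))) (P.prod ν)) :
    IsPolledDM1 (P.prod ν) p μ (fun n z => polled n z.1) (fun n z => service n z.1) T where
  measurable_polled n := (h.measurable_polled n).comp measurable_fst
  measurable_service n := (h.measurable_service n).comp measurable_fst
  measurable_init := hT
  prob_polled n := by
    have := measurePreserving_fst (μ := P) (ν := ν) |>.measure_preimage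
      (h.measurable_polled n (measurableSet_singleton true)).nullMeasurableSet
    rw [← h.prob_polled n]
    exact this
  law_service n := by
    rw [← h.law_service n, ← measurePreserving_fst (μ := P) (ν := ν) |>.map_eq,
      Measure.map_map (h.measurable_service n) measurable_fst, measurePreserving_fst.map_eq]
    rfl
  init_nonneg := hT0
  indep_polled := iIndepFun_comp_fst h.indep_polled h.measurable_polled
  indep_service := iIndepFun_comp_fst h.indep_service h.measurable_service
  indep_polled_service := indepFun_comp_fst h.indep_polled_service
    (measurable_pi_lambda _ h.measurable_polled) (measurable_pi_lambda _ h.measurable_service)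
  indep_init := hind

theorem prod_fst [IsProbabilityMeasure P] (h : IsPolledDM1 P p μ polled service T₀)
    (ν : Measure ℝ) [IsProbabilityMeasure ν] :
    IsPolledDM1 (P.prod ν) p μ (fun n z => polled n z.1) (fun n z => service n z.1)
      (fun z => T₀ z.1) :=
  h.prod (h.measurable_init.comp measurable_fst)
    (measurePreserving_fst.quasiMeasurePreserving.ae h.init_nonneg)
    (indepFun_comp_fst h.indep_init h.measurable_init
      ((measurable_pi_lambda _ h.measurable_polled).prodMk
        (measurable_pi_lambda _ h.measurable_service)))

theorem prod_snd [IsProbabilityMeasure P] (h : IsPolledDM1 P p μ polled service T₀)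
    {ν : Measure ℝ} [IsProbabilityMeasure ν] (hν : ∀ᵐ x ∂ν, 0 ≤ x) :
    IsPolledDM1 (P.prod ν) p μ (fun n z => polled n z.1) (fun n z => service n z.1)
      (fun z => z.2) :=
  h.prod measurable_snd (measurePreserving_snd.quasiMeasurePreserving.ae hν)
    (indepFun_prod ((measurable_pi_lambda _ h.measurable_polled).prodMk
        (measurable_pi_lambda _ h.measurable_service)) measurable_id).symm

end IsPolledDM1

/-! ### Exponential variables -/

section exponential

variable {E : Type*} [NormedAddCommGroup E] [NormedSpace ℝ E] {r : ℝ}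

theorem toReal_gammaPDF_one_smul_ae_eq (hr : 0 < r) (f : ℝ → E) :
    (fun x => (gammaPDF 1 r x).toReal • f x) =ᵐ[volume]
      (Set.Ioi (0 : ℝ)).indicator fun x => (r * Real.exp (-(r * x))) • f x := by
  filter_upwards [Measure.ae_ne volume (0 : ℝ)] with x hx
  rw [gammaPDF, ENNReal.toReal_ofReal (gammaPDFReal_nonneg one_pos hr x), gammaPDFReal]
  by_cases h : 0 < x
  · rw [Set.indicator_of_mem (Set.mem_Ioi.2 h), if_pos h.le]
    simp
  · rw [Set.indicator_of_notMem (by simpa using h), if_neg fun h' => h (lt_of_le_of_ne h' hx.symm),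
      zero_smul]

theorem measurable_gammaPDF (a r : ℝ) : Measurable (gammaPDF a r) :=
  (measurable_gammaPDFReal a r).ennreal_ofReal

theorem integral_expMeasure (hr : 0 < r) (f : ℝ → E) :
    ∫ x, f x ∂expMeasure r =
      ∫ x, (Set.Ioi (0 : ℝ)).indicator (fun x => (r * Real.exp (-(r * x))) • f x) x := by
  rw [expMeasure, gammaMeasure, integral_withDensity_eq_integral_toReal_smul
    (measurable_gammaPDF 1 r) (ae_of_all _ fun _ => ENNReal.ofReal_lt_top)]
  exact integral_congr_ae (toReal_gammaPDF_one_smul_ae_eq hr f)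

theorem integrable_expMeasure_iff (hr : 0 < r) (f : ℝ → E) :
    Integrable f (expMeasure r) ↔
      Integrable ((Set.Ioi (0 : ℝ)).indicator fun x => (r * Real.exp (-(r * x))) • f x) := by
  rw [expMeasure, gammaMeasure, integrable_withDensity_iff_integrable_smul'
    (measurable_gammaPDF 1 r) (ae_of_all _ fun _ => ENNReal.ofReal_lt_top)]
  exact integrable_congr (toReal_gammaPDF_one_smul_ae_eq hr f)

theorem ae_nonneg_expMeasure (r : ℝ) : ∀ᵐ x ∂expMeasure r, 0 ≤ x := by
  have : expMeasure r (Set.Iio 0) = 0 := by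
    rw [expMeasure, gammaMeasure, withDensity_apply _ measurableSet_Iio]
    exact lintegral_gammaPDF_of_nonpos le_rfl
  refine measure_mono_null (fun x hx => ?_) this
  simpa using hx

/-- The exponential law has no memory: exceeding `x` has probability `exp (-r x)`, and the excess
is again exponential. -/
theorem integral_max_sub_expMeasure [CompleteSpace E] (hr : 0 < r) {g : ℝ → E}
    (hg : Integrable g (expMeasure r)) {x : ℝ} (hx : 0 ≤ x) :
    ∫ t, g (max (t - x) 0) ∂expMeasure r =
      (1 - Real.exp (-(r * x))) • g 0 + Real.exp (-(r * x)) • ∫ t, g t ∂expMeasure r := by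
  rw [integral_expMeasure hr, integral_expMeasure hr g]
  set F : ℝ → E := (Set.Ioi (0 : ℝ)).indicator fun x => (r * Real.exp (-(r * x))) • g x with hF
  have hFi : Integrable F := (integrable_expMeasure_iff hr g).1 hg
  have hsplit : ∀ t, (Set.Ioi (0 : ℝ)).indicator
      (fun t => (r * Real.exp (-(r * t))) • g (max (t - x) 0)) t =
      (Set.Ioc 0 x).indicator (fun t => (r * Real.exp (-(r * t))) • g 0) t +
        Real.exp (-(r * x)) • F (t - x) := by
    intro t
    rcases le_or_gt t 0 with h0 | h0
    · rw [Set.indicator_of_notMem (by simpa using h0),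
        Set.indicator_of_notMem (fun h => absurd h.1 (not_lt.2 h0)), hF,
        Set.indicator_of_notMem (by simp; linarith)]
      simp
    · rcases le_or_gt t x with h1 | h1
      · rw [Set.indicator_of_mem (Set.mem_Ioi.2 h0), Set.indicator_of_mem (Set.mem_Ioc.2 ⟨h0, h1⟩), hF,
          Set.indicator_of_notMem (by simpa using h1), max_eq_right (by linarith)]
        simp
      · rw [Set.indicator_of_mem (Set.mem_Ioi.2 h0),
          Set.indicator_of_notMem (fun h => absurd h.2 (not_le.2 h1)), hF,
          Set.indicator_of_mem (by simpa using h1), max_eq_left (by linarith), zero_add, smul_smul]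
        congr 1
        rw [mul_left_comm, ← Real.exp_add]
        ring_nf
  have hIoc : Integrable ((Set.Ioc 0 x).indicator fun t => (r * Real.exp (-(r * t))) • g 0) := by
    rw [integrable_indicator_iff measurableSet_Ioc]
    exact (Continuous.integrableOn_Icc (by fun_prop)).mono_set Set.Ioc_subset_Icc_self
  simp_rw [hsplit]
  rw [integral_add (g := fun t => Real.exp (-(r * x)) • F (t - x)) hIoc
      ((hFi.comp_sub_right x).smul (Real.exp (-(r * x)))), integral_smul,
    integral_sub_right_eq_self F x, integral_indicator measurableSet_Ioc, integral_smul_const,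
    ← intervalIntegral.integral_of_le hx]
  congr 2
  rw [intervalIntegral.integral_eq_sub_of_hasDerivAt (f := fun t => -Real.exp (-(r * t)))
    (fun t _ => ?_) (Continuous.intervalIntegrable (by fun_prop) _ _)]
  · simp; ring
  · have := (((hasDerivAt_id t).const_mul r).neg.exp).neg
    refine this.congr_deriv ?_
    simp; ring

theorem integral_id_expMeasure (hr : 0 < r) : ∫ x, x ∂expMeasure r = 1 / r := by
  rw [integral_expMeasure hr (fun x => x), integral_indicator measurableSet_Ioi]
  have := Real.integral_rpow_mul_exp_neg_mul_Ioi (a := 2) two_pos hr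
  simp only [smul_eq_mul]
  rw [setIntegral_congr_fun (g := fun t => r * (t ^ ((2 : ℝ) - 1) * Real.exp (-(r * t))))
    measurableSet_Ioi fun t _ => ?_, integral_const_mul, this]
  · rw [Real.Gamma_two]
    rw [show ((1 : ℝ) / r) ^ (2 : ℝ) = (1 / r) ^ (2 : ℕ) from Real.rpow_natCast _ 2]
    field_simp
  · have h2 : (2 : ℝ) - 1 = 1 := by norm_num
    simp only [h2, Real.rpow_one]
    ring

theorem integrable_id_expMeasure (hr : 0 < r) : Integrable (fun x => x) (expMeasure r) :=
  .of_integral_ne_zero (by rw [integral_id_expMeasure hr]; positivity)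

open Complex in
theorem charFun_expMeasure (hr : 0 < r) (t : ℝ) :
    charFun (expMeasure r) t = r / (r - t * I) := by
  rw [charFun_apply_real, integral_expMeasure hr, integral_indicator measurableSet_Ioi]
  have hre : (-(r - t * I : ℂ)).re < 0 := by simpa using hr
  rw [setIntegral_congr_fun (g := fun x : ℝ => (r : ℂ) * cexp (-(r - t * I) * x))
    measurableSet_Ioi fun x _ => ?_, integral_const_mul, integral_exp_mul_complex_Ioi hre]
  · rw [ofReal_zero, mul_zero, Complex.exp_zero, neg_div_neg_eq, mul_one_div]
  · simp only [real_smul, ofReal_mul, ofReal_exp, ofReal_neg]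
    rw [mul_assoc, ← Complex.exp_add]
    ring_nf

end exponential

/-! ### Geometric series -/

theorem hasSum_succ_mul_geometric {q : ℝ} (hq0 : 0 ≤ q) (hq1 : q < 1) :
    HasSum (fun k : ℕ => ((k : ℝ) + 1) * q ^ k) (1 / (1 - q) ^ 2) := by
  have := hasSum_choose_mul_geometric_of_norm_lt_one 1
    (show ‖q‖ < 1 by rwa [Real.norm_of_nonneg hq0])
  simpa using this

theorem hasSum_succ_mul_mul_geometric {q : ℝ} (hq0 : 0 ≤ q) (hq1 : q < 1) :
    HasSum (fun k : ℕ => ((k : ℝ) + 1) * k * q ^ k) (2 * q / (1 - q) ^ 3) := by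
  have h := (hasSum_choose_mul_geometric_of_norm_lt_one 2
    (show ‖q‖ < 1 by rwa [Real.norm_of_nonneg hq0])).mul_left (2 * q)
  have hz : ∑ i ∈ Finset.range 1, ((i : ℝ) + 1) * i * q ^ i = 0 := by simp
  rw [← hasSum_nat_add_iff' 1, hz, sub_zero]
  rw [mul_one_div] at h
  refine (congrArg (fun f : ℕ → ℝ => HasSum f _) (funext fun k => ?_)).mp h
  rw [Nat.cast_choose_two]
  push_cast
  ring

section geometric

variable {p : ℝ}

theorem integrable_and_integral_geometricMeasure (hp0 : 0 < p) (hp1 : p ≤ 1) {f : ℕ → ℝ}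
    (hf : ∀ k, 0 ≤ f k) {s : ℝ} (h : HasSum (fun k => (1 - p) ^ k * p * f k) s) :
    Integrable f (geometricMeasure (successProb hp0 hp1)) ∧
      ∫ k, f k ∂geometricMeasure (successProb hp0 hp1) = s := by
  have hne := successProb_ne_zero hp0 hp1
  refine ⟨(integrable_geometricMeasure_iff hne).2 ?_, ?_⟩
  · refine h.summable.congr fun k => ?_
    rw [Real.norm_of_nonneg (hf k)]
    rfl
  · rw [integral_geometricMeasure hne]
    exact h.tsum_eq

theorem geometric_mean_succ (hp0 : 0 < p) (hp1 : p ≤ 1) :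
    Integrable (fun k : ℕ => (k : ℝ) + 1) (geometricMeasure (successProb hp0 hp1)) ∧
      ∫ k : ℕ, ((k : ℝ) + 1) ∂geometricMeasure (successProb hp0 hp1) = 1 / p := by
  refine integrable_and_integral_geometricMeasure hp0 hp1 (fun k => by positivity) ?_
  have h := (hasSum_succ_mul_geometric (q := 1 - p) (by linarith) (by linarith)).mul_left p
  have e : p * (1 / (1 - (1 - p)) ^ 2) = 1 / p := by rw [sub_sub_cancel]; field_simp
  rw [e] at h
  refine (congrArg (fun f : ℕ → ℝ => HasSum f _) (funext fun k => ?_)).mp h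
  ring

theorem geometric_mean_succ_mul (hp0 : 0 < p) (hp1 : p ≤ 1) :
    Integrable (fun k : ℕ => ((k : ℝ) + 1) * k) (geometricMeasure (successProb hp0 hp1)) ∧
      ∫ k : ℕ, ((k : ℝ) + 1) * k ∂geometricMeasure (successProb hp0 hp1) =
        2 * (1 - p) / p ^ 2 := by
  refine integrable_and_integral_geometricMeasure hp0 hp1 (fun k => by positivity) ?_
  have h := (hasSum_succ_mul_mul_geometric (q := 1 - p) (by linarith) (by linarith)).mul_left p
  have e : p * (2 * (1 - p) / (1 - (1 - p)) ^ 3) = 2 * (1 - p) / p ^ 2 := by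
    rw [sub_sub_cancel]; field_simp
  rw [e] at h
  refine (congrArg (fun f : ℕ → ℝ => HasSum f _) (funext fun k => ?_)).mp h
  ring

theorem geometric_mean_pow (hp0 : 0 < p) (hp1 : p ≤ 1) {z : ℝ} (hz0 : 0 ≤ z) (hz1 : z < 1) :
    Integrable (fun k : ℕ => z ^ (k + 1)) (geometricMeasure (successProb hp0 hp1)) ∧
      ∫ k : ℕ, z ^ (k + 1) ∂geometricMeasure (successProb hp0 hp1) =
        p * z / (1 - (1 - p) * z) := by
  refine integrable_and_integral_geometricMeasure hp0 hp1 (fun k => by positivity) ?_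
  have h := (hasSum_geometric_of_lt_one (mul_nonneg (sub_nonneg.2 hp1) hz0)
    (by linarith [den_pos hp0 hz0 hz1])).mul_left (p * z)
  rw [← div_eq_mul_inv] at h
  refine (congrArg (fun f : ℕ → ℝ => HasSum f _) (funext fun k => ?_)).mp h
  rw [mul_pow]
  ring

theorem geometric_mean_succ_mul_pow (hp0 : 0 < p) (hp1 : p ≤ 1) {z : ℝ} (hz0 : 0 ≤ z)
    (hz1 : z < 1) :
    Integrable (fun k : ℕ => ((k : ℝ) + 1) * z ^ (k + 1))
        (geometricMeasure (successProb hp0 hp1)) ∧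
      ∫ k : ℕ, ((k : ℝ) + 1) * z ^ (k + 1) ∂geometricMeasure (successProb hp0 hp1) =
        p * z / (1 - (1 - p) * z) ^ 2 := by
  refine integrable_and_integral_geometricMeasure hp0 hp1 (fun k => by positivity) ?_
  have h := (hasSum_succ_mul_geometric (mul_nonneg (sub_nonneg.2 hp1) hz0)
    (by linarith [den_pos hp0 hz0 hz1])).mul_left (p * z)
  rw [mul_one_div] at h
  refine (congrArg (fun f : ℕ → ℝ => HasSum f _) (funext fun k => ?_)).mp h
  rw [mul_pow]
  ring

end geometric

/-! ### The waiting time against an exponential system time -/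

section waiting

variable {p μ D β : ℝ}

/-- `waitFun D (x, k)` is the waiting time of an update whose predecessor has system time `x`, when
`k` waypoints are skipped in between. -/
noncomputable def waitFun (D : ℝ) (z : ℝ × ℕ) : ℝ := max (z.1 - (z.2 + 1) * D) 0

theorem waitFun_nonneg (D : ℝ) (z : ℝ × ℕ) : 0 ≤ waitFun D z := le_max_right _ _

theorem waitFun_le_abs (hD : 0 < D) (z : ℝ × ℕ) : waitFun D z ≤ |z.1| := by
  refine max_le ?_ (abs_nonneg _)
  have := le_abs_self z.1
  have : 0 ≤ ((z.2 : ℝ) + 1) * D := by positivity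
  linarith

theorem abs_waitFun_sub_le (D x y : ℝ) (k : ℕ) :
    |waitFun D (x, k) - waitFun D (y, k)| ≤ |x - y| := by
  refine (abs_max_sub_max_le_abs _ _ _).trans_eq ?_
  simp only [sub_sub_sub_cancel_right]

theorem measurable_succ_snd : Measurable fun z : ℝ × ℕ => (z.2 : ℝ) + 1 :=
  (measurable_from_top (f := fun n : ℕ => (n : ℝ) + 1)).comp measurable_snd

theorem measurable_waitFun (D : ℝ) : Measurable (waitFun D) :=
  (measurable_fst.sub (measurable_succ_snd.mul_const D)).max measurable_const

theorem exp_neg_rate_mul (μ D β : ℝ) (k : ℕ) :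
    Real.exp (-(μ * (1 - β) * ((k + 1) * D))) = Real.exp (-μ * (1 - β) * D) ^ (k + 1) := by
  rw [← Real.exp_nat_mul]
  congr 1
  push_cast
  ring

/-- If the system time is exponential of rate `μ (1 - β)` with `β` the root, then the next update
has to wait with probability `β`, and its waiting time is then again exponential of that rate. -/
theorem integral_comp_waitFun (hD : 0 < D) (hp0 : 0 < p) (hp1 : p ≤ 1) (hμ : 0 < μ) (hβ : β < 1)
    (hroot : IsRoot p μ D β) {g : ℝ → ℂ} (hg : Measurable g) (hb : ∀ x, ‖g x‖ ≤ 1) :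
    ∫ z, g (waitFun D z) ∂((expMeasure (μ * (1 - β))).prod
        (geometricMeasure (successProb hp0 hp1))) =
      (1 - β) • g 0 + β • ∫ x, g x ∂expMeasure (μ * (1 - β)) := by
  have hr : 0 < μ * (1 - β) := mul_pos hμ (sub_pos.2 hβ)
  have := isProbabilityMeasure_expMeasure hr
  obtain ⟨hi, hint⟩ := geometric_mean_pow hp0 hp1 (Real.exp_pos (-μ * (1 - β) * D)).le
    (exp_neg_mul_lt_one hD hμ hβ)
  have hgi : Integrable g (expMeasure (μ * (1 - β))) :=
    Integrable.of_bound hg.aestronglyMeasurable 1 (ae_of_all _ hb)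
  rw [integral_prod_symm (fun z => g (waitFun D z)) (Integrable.of_bound
    (hg.comp (measurable_waitFun D)).aestronglyMeasurable 1 (ae_of_all _ fun z => hb _))]
  have hk : ∀ k : ℕ, ∫ x, g (waitFun D (x, k)) ∂expMeasure (μ * (1 - β)) =
      (1 - Real.exp (-μ * (1 - β) * D) ^ (k + 1)) • g 0 +
        Real.exp (-μ * (1 - β) * D) ^ (k + 1) • ∫ x, g x ∂expMeasure (μ * (1 - β)) := by
    intro k
    rw [← exp_neg_rate_mul]
    exact integral_max_sub_expMeasure hr hgi (x := (k + 1) * D) (by positivity)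
  simp_rw [hk]
  have hi' : Integrable (fun k : ℕ => 1 - Real.exp (-μ * (1 - β) * D) ^ (k + 1))
      (geometricMeasure (successProb hp0 hp1)) := (integrable_const _).sub hi
  rw [integral_add (hi'.smul_const _) (hi.smul_const _),
    integral_smul_const, integral_smul_const, integral_sub (integrable_const _) hi, hint,
    ← (show β = _ from hroot)]
  simp

theorem integrable_succ_mul_waitFun (hp0 : 0 < p) (hp1 : p ≤ 1) (hD : 0 < D) {ν : Measure ℝ}
    [IsProbabilityMeasure ν] (hν : Integrable (fun x => x) ν) :
    Integrable (fun z : ℝ × ℕ => ((z.2 : ℝ) + 1) * waitFun D z)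
      (ν.prod (geometricMeasure (successProb hp0 hp1))) := by
  refine (hν.norm.mul_prod (geometric_mean_succ hp0 hp1).1).mono'
    (measurable_succ_snd.mul (measurable_waitFun D)).aestronglyMeasurable
    (ae_of_all _ fun z => ?_)
  have h1 : (0 : ℝ) ≤ (z.2 : ℝ) + 1 := by positivity
  rw [Real.norm_of_nonneg (mul_nonneg h1 (waitFun_nonneg D z)), mul_comm]
  exact mul_le_mul_of_nonneg_right (waitFun_le_abs hD z) h1

theorem integral_succ_mul_waitFun (hD : 0 < D) (hp0 : 0 < p) (hp1 : p ≤ 1) (hμ : 0 < μ)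
    (hβ : β < 1) :
    ∫ z : ℝ × ℕ, ((z.2 : ℝ) + 1) * waitFun D z ∂((expMeasure (μ * (1 - β))).prod
        (geometricMeasure (successProb hp0 hp1))) =
      p * Real.exp (-μ * (1 - β) * D) /
        (μ * (1 - β) * (1 - (1 - p) * Real.exp (-μ * (1 - β) * D)) ^ 2) := by
  have hr : 0 < μ * (1 - β) := mul_pos hμ (sub_pos.2 hβ)
  have := isProbabilityMeasure_expMeasure hr
  have hid := integrable_id_expMeasure hr
  obtain ⟨hi, hint⟩ := geometric_mean_succ_mul_pow hp0 hp1 (Real.exp_pos (-μ * (1 - β) * D)).le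
    (exp_neg_mul_lt_one hD hμ hβ)
  rw [integral_prod_symm _ (integrable_succ_mul_waitFun hp0 hp1 hD hid)]
  have hk : ∀ k : ℕ, ∫ x, ((k : ℝ) + 1) * waitFun D (x, k) ∂expMeasure (μ * (1 - β)) =
      ((k : ℝ) + 1) * Real.exp (-μ * (1 - β) * D) ^ (k + 1) * (1 / (μ * (1 - β))) := by
    intro k
    rw [integral_const_mul, mul_assoc, ← exp_neg_rate_mul, ← integral_id_expMeasure hr]
    congr 1
    simpa [waitFun] using integral_max_sub_expMeasure hr hid (x := (k + 1) * D) (by positivity)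
  simp_rw [hk]
  rw [integral_mul_const, hint, mul_one_div, div_div, mul_comm (_ ^ 2)]

end waiting

/-! ### One step of the queue -/

theorem sysTime_zero (D : ℝ) (polled : ℕ → Ω → Bool) (service : ℕ → Ω → ℝ) (T₀ : Ω → ℝ) :
    sysTime D polled service T₀ 0 = T₀ := by
  funext ω
  simp [sysTime, depTime]

namespace IsPolledDM1

variable [mΩ : MeasurableSpace Ω] {P : Measure Ω} {p μ : ℝ} {polled : ℕ → Ω → Bool}
  {service : ℕ → Ω → ℝ} {T₀ : Ω → ℝ}

theorem sysTime_measurable (h : IsPolledDM1 P p μ polled service T₀) (D : ℝ) (i : ℕ) :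
    Measurable (sysTime D polled service T₀ i) :=
  measurable_sysTime D h.measurable_polled h.measurable_service h.measurable_init i

theorem skips_measurable (h : IsPolledDM1 P p μ polled service T₀) (i : ℕ) :
    Measurable (skips polled i) :=
  measurable_skips h.measurable_polled i

theorem integrable_service (h : IsPolledDM1 P p μ polled service T₀) (hμ : 0 < μ) (n : ℕ) :
    Integrable (service n) P := by
  have := integrable_id_expMeasure hμ
  rw [← h.law_service n] at this
  exact this.comp_measurable (h.measurable_service n)

theorem integral_service (h : IsPolledDM1 P p μ polled service T₀) (hμ : 0 < μ) (n : ℕ) :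
    ∫ ω, service n ω ∂P = 1 / μ := by
  rw [← integral_id_expMeasure hμ, ← h.law_service n,
    integral_map (f := fun x : ℝ => x) (h.measurable_service n).aemeasurable
      measurable_id.aestronglyMeasurable]

theorem ae_service_nonneg (h : IsPolledDM1 P p μ polled service T₀) :
    ∀ᵐ ω ∂P, ∀ n, 0 ≤ service n ω := by
  refine ae_all_iff.2 fun n => ?_
  have := ae_nonneg_expMeasure μ
  rw [← h.law_service n] at this
  exact ae_of_ae_map (h.measurable_service n).aemeasurable this

theorem integrable_comp_skips [IsProbabilityMeasure P]
    (h : IsPolledDM1 P p μ polled service T₀) (hp0 : 0 < p) (hp1 : p ≤ 1) {f : ℕ → ℝ}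
    (hf : Integrable f (geometricMeasure (successProb hp0 hp1))) (i : ℕ) :
    Integrable (fun ω => f (skips polled i ω)) P := by
  rw [← h.map_skips hp0 hp1 i] at hf
  exact hf.comp_measurable (h.skips_measurable i)

theorem integral_comp_skips [IsProbabilityMeasure P]
    (h : IsPolledDM1 P p μ polled service T₀) (hp0 : 0 < p) (hp1 : p ≤ 1) (f : ℕ → ℝ) (i : ℕ) :
    ∫ ω, f (skips polled i ω) ∂P = ∫ k, f k ∂geometricMeasure (successProb hp0 hp1) := by
  rw [← h.map_skips hp0 hp1 i, integral_map (h.skips_measurable i).aemeasurable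
    measurable_from_top.aestronglyMeasurable]

theorem map_state [IsProbabilityMeasure P] (h : IsPolledDM1 P p μ polled service T₀)
    (hp0 : 0 < p) (hp1 : p ≤ 1) (D : ℝ) (i : ℕ) :
    P.map (fun ω => (sysTime D polled service T₀ i ω, skips polled i ω)) =
      (P.map (sysTime D polled service T₀ i)).prod (geometricMeasure (successProb hp0 hp1)) := by
  rw [← h.map_skips hp0 hp1 i]
  exact (indepFun_iff_map_prod_eq_prod_map_map (h.sysTime_measurable D i).aemeasurable
    (h.skips_measurable i).aemeasurable).1 (h.indepFun_sysTime_skips hp0 hp1 D i)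

theorem state_measurable (h : IsPolledDM1 P p μ polled service T₀) (D : ℝ) (i : ℕ) :
    Measurable fun ω => (sysTime D polled service T₀ i ω, skips polled i ω) :=
  (h.sysTime_measurable D i).prodMk (h.skips_measurable i)

theorem ae_sysTime_succ [IsProbabilityMeasure P] (h : IsPolledDM1 P p μ polled service T₀)
    (hp0 : 0 < p) (D : ℝ) : ∀ᵐ ω ∂P, ∀ i, sysTime D polled service T₀ (i + 1) ω =
      waitFun D (sysTime D polled service T₀ i ω, skips polled i ω) + service (i + 1) ω := by
  filter_upwards [h.ae_pollsForever hp0] with ω hω i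
  exact hω.sysTime_succ D service T₀ i

theorem ae_sysTime_nonneg [IsProbabilityMeasure P] (h : IsPolledDM1 P p μ polled service T₀)
    (hp0 : 0 < p) (D : ℝ) : ∀ᵐ ω ∂P, ∀ i, 0 ≤ sysTime D polled service T₀ i ω := by
  filter_upwards [h.ae_sysTime_succ hp0 D, h.ae_service_nonneg, h.init_nonneg] with ω h1 h2 h3 i
  cases i with
  | zero => rwa [sysTime_zero]
  | succ i => rw [h1]; exact add_nonneg (le_max_right _ _) (h2 _)

/-- The exponential law of rate `μ (1 - β)` is invariant: the waiting time has the law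
`(1 - β) δ₀ + β Exp (μ (1 - β))`, and adding an independent service time turns this mixture into
`Exp (μ (1 - β))` again, as the characteristic functions show. -/
theorem map_sysTime_succ [IsProbabilityMeasure P] (h : IsPolledDM1 P p μ polled service T₀)
    {D β : ℝ} (hD : 0 < D) (hp0 : 0 < p) (hp1 : p ≤ 1) (hμ : 0 < μ) (hβ : β < 1)
    (hroot : IsRoot p μ D β) {i : ℕ}
    (hi : P.map (sysTime D polled service T₀ i) = expMeasure (μ * (1 - β))) :
    P.map (sysTime D polled service T₀ (i + 1)) = expMeasure (μ * (1 - β)) := by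
  have hr : 0 < μ * (1 - β) := mul_pos hμ (sub_pos.2 hβ)
  have := isProbabilityMeasure_expMeasure hr
  have hT := h.sysTime_measurable D (i + 1)
  have hst := h.state_measurable D i
  have : IsProbabilityMeasure (P.map (sysTime D polled service T₀ (i + 1))) :=
    Measure.isProbabilityMeasure_map hT.aemeasurable
  let W : Ω → ℝ := fun ω => waitFun D (sysTime D polled service T₀ i ω, skips polled i ω)
  have hW : Measurable W := (measurable_waitFun D).comp hst
  refine Measure.ext_of_charFun (funext fun s => ?_)
  have hind : IndepFun W (service (i + 1)) P :=
    (h.indepFun_state_service D i).comp (measurable_waitFun D) measurable_id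
  have hsum : P.map (sysTime D polled service T₀ (i + 1)) = P.map (W + service (i + 1)) :=
    Measure.map_congr (by
      filter_upwards [h.ae_sysTime_succ hp0 D] with ω hω
      exact hω i)
  have hg : Measurable fun x : ℝ => Complex.exp (s * x * Complex.I) := by fun_prop
  have hWc : charFun (P.map W) s =
      (1 - β) + β * ((μ * (1 - β) : ℝ) / ((μ * (1 - β) : ℝ) - s * Complex.I)) := by
    have key := integral_comp_waitFun hD hp0 hp1 hμ hβ hroot hg (fun x => by
      rw [← Complex.ofReal_mul, Complex.norm_exp_ofReal_mul_I])
    rw [← charFun_apply_real, charFun_expMeasure hr, ← hi, ← h.map_state hp0 hp1 D i,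
      integral_map (f := fun z => Complex.exp (s * waitFun D z * Complex.I)) hst.aemeasurable
        (hg.comp (measurable_waitFun D)).aestronglyMeasurable] at key
    rw [charFun_apply_real, integral_map hW.aemeasurable hg.aestronglyMeasurable]
    simpa [Complex.real_smul] using key
  rw [hsum, hind.charFun_map_add_eq_mul hW.aemeasurable (h.measurable_service _).aemeasurable,
    Pi.mul_apply, hWc, h.law_service, charFun_expMeasure hμ, charFun_expMeasure hr]
  have n1 : ((μ * (1 - β) : ℝ) : ℂ) - s * Complex.I ≠ 0 := fun h0 => by
    have := congrArg Complex.re h0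
    simp at this
    rcases this with h0 | h0 <;> linarith
  have n2 : (μ : ℂ) - s * Complex.I ≠ 0 := fun h0 => by
    have := congrArg Complex.re h0
    simp at this
    linarith
  field_simp
  push_cast
  ring

/-! ### The mean area -/

/-- The area in terms of the interarrival time, the waiting time and the service time. -/
theorem ae_areaQ_eq [IsProbabilityMeasure P] (h : IsPolledDM1 P p μ polled service T₀)
    {D : ℝ} (hD : 0 < D) (hp0 : 0 < p) (v : ℝ) (i : ℕ) :
    ∀ᵐ ω ∂P, areaQ v D polled service T₀ i ω =
      v ^ 2 * D ^ 3 * (((skips polled i ω : ℝ) + 1) / 3 +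
        ((skips polled i ω : ℝ) + 1) * skips polled i ω / 2) +
      v ^ 2 * D ^ 2 * (((skips polled i ω : ℝ) + 1) *
          waitFun D (sysTime D polled service T₀ i ω, skips polled i ω) +
        ((skips polled i ω : ℝ) + 1) * service (i + 1) ω) := by
  filter_upwards [h.ae_pollsForever hp0, h.ae_sysTime_succ hp0 D, h.ae_sysTime_nonneg hp0 D]
    with ω h1 h2 h3
  have hT := h3 (i + 1)
  have hT' := h2 i
  rw [sysTime] at hT hT'
  have hg : genTime D polled (i + 1) ω =
      (genIndex polled ω i + (skips polled i ω + 1) : ℕ) * D := by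
    rw [genTime, h1.genIndex_succ i]
  rw [areaQ, hg, genTime, integral_pebGrowth hD, integral_pebGrowth_sub hD _ _ (by
    rw [← hg]; linarith), ← hg, hT']
  push_cast
  ring

theorem integrable_areaQ_and_integral [IsProbabilityMeasure P]
    (h : IsPolledDM1 P p μ polled service T₀) {D : ℝ} (hD : 0 < D) (hp0 : 0 < p) (hp1 : p ≤ 1)
    (hμ : 0 < μ) (v : ℝ) {i : ℕ} (hi : Integrable (sysTime D polled service T₀ i) P) :
    Integrable (areaQ v D polled service T₀ i) P ∧
      ∫ ω, areaQ v D polled service T₀ i ω ∂P =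
        v ^ 2 * D ^ 3 / (3 * p) + v ^ 2 * D ^ 3 * (1 - p) / p ^ 2 +
          v ^ 2 * D ^ 2 * (∫ z, ((z.2 : ℝ) + 1) * waitFun D z
            ∂((P.map (sysTime D polled service T₀ i)).prod
              (geometricMeasure (successProb hp0 hp1))) + 1 / (μ * p)) := by
  have hT := h.sysTime_measurable D i
  have : IsProbabilityMeasure (P.map (sysTime D polled service T₀ i)) :=
    Measure.isProbabilityMeasure_map hT.aemeasurable
  have hst := h.state_measurable D i
  have hHm : Measurable fun z : ℝ × ℕ => ((z.2 : ℝ) + 1) * waitFun D z :=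
    measurable_succ_snd.mul (measurable_waitFun D)
  have a1 := h.integrable_comp_skips hp0 hp1 (geometric_mean_succ hp0 hp1).1 i
  have a2 := h.integrable_comp_skips hp0 hp1 (geometric_mean_succ_mul hp0 hp1).1 i
  have a3 : Integrable (fun ω => ((skips polled i ω : ℝ) + 1) *
      waitFun D (sysTime D polled service T₀ i ω, skips polled i ω)) P := by
    have := integrable_succ_mul_waitFun hp0 hp1 hD
      (ν := P.map (sysTime D polled service T₀ i))
      ((integrable_map_measure measurable_id.aestronglyMeasurable hT.aemeasurable).2 hi)
    rw [← h.map_state hp0 hp1 D i] at this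
    exact this.comp_measurable hst
  have hind : IndepFun (fun ω => (skips polled i ω : ℝ) + 1) (service (i + 1)) P :=
    (h.indepFun_skips_service i).comp (φ := fun k : ℕ => (k : ℝ) + 1) measurable_from_top
      measurable_id
  have a4 : Integrable (fun ω => ((skips polled i ω : ℝ) + 1) * service (i + 1) ω) P :=
    hind.integrable_mul a1 (h.integrable_service hμ _)
  have e1 := (h.integral_comp_skips hp0 hp1 (fun k => (k : ℝ) + 1) i).trans
    (geometric_mean_succ hp0 hp1).2
  have e2 := (h.integral_comp_skips hp0 hp1 (fun k => ((k : ℝ) + 1) * k) i).trans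
    (geometric_mean_succ_mul hp0 hp1).2
  have e3 : ∫ ω, ((skips polled i ω : ℝ) + 1) *
      waitFun D (sysTime D polled service T₀ i ω, skips polled i ω) ∂P =
      ∫ z, ((z.2 : ℝ) + 1) * waitFun D z ∂((P.map (sysTime D polled service T₀ i)).prod
        (geometricMeasure (successProb hp0 hp1))) := by
    rw [← h.map_state hp0 hp1 D i, integral_map hst.aemeasurable hHm.aestronglyMeasurable]
  have e4 : ∫ ω, ((skips polled i ω : ℝ) + 1) * service (i + 1) ω ∂P = 1 / p * (1 / μ) := by
    rw [hind.integral_fun_mul_eq_mul_integral a1.aestronglyMeasurable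
      (h.measurable_service _).aestronglyMeasurable, e1, h.integral_service hμ]
  have b1 : Integrable (fun ω => v ^ 2 * D ^ 3 * (((skips polled i ω : ℝ) + 1) / 3 +
      ((skips polled i ω : ℝ) + 1) * skips polled i ω / 2)) P :=
    ((a1.div_const 3).add (a2.div_const 2)).const_mul _
  have b2 : Integrable (fun ω => v ^ 2 * D ^ 2 * (((skips polled i ω : ℝ) + 1) *
          waitFun D (sysTime D polled service T₀ i ω, skips polled i ω) +
        ((skips polled i ω : ℝ) + 1) * service (i + 1) ω)) P := (a3.add a4).const_mul _
  have hae := h.ae_areaQ_eq hD hp0 v i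
  refine ⟨(b1.add b2).congr (hae.mono fun ω hω => hω.symm), ?_⟩
  rw [integral_congr_ae hae, integral_add b1 b2, integral_const_mul, integral_const_mul,
    integral_add (a1.div_const 3) (a2.div_const 2), integral_add a3 a4, integral_div,
    integral_div, e1, e2, e3, e4]
  field_simp

theorem integrable_sysTime [IsProbabilityMeasure P] (h : IsPolledDM1 P p μ polled service T₀)
    {D : ℝ} (hD : 0 < D) (hp0 : 0 < p) (hμ : 0 < μ) (h0 : Integrable T₀ P) (i : ℕ) :
    Integrable (sysTime D polled service T₀ i) P := by
  induction i with
  | zero => rwa [sysTime_zero]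
  | succ i ih =>
    refine (ih.add (h.integrable_service hμ (i + 1))).mono'
      (h.sysTime_measurable D (i + 1)).aestronglyMeasurable ?_
    filter_upwards [h.ae_sysTime_succ hp0 D, h.ae_sysTime_nonneg hp0 D] with ω h1 h2
    rw [Real.norm_of_nonneg (h2 _), h1, Pi.add_apply]
    refine add_le_add_left ((waitFun_le_abs hD _).trans_eq ?_) _
    rw [abs_of_nonneg (h2 i)]

/-! ### Coupling of two queues with the same input -/

/-- The partial sums of service times minus interarrival times drift to `-∞`, by the strong law of
large numbers. -/
theorem ae_tendsto_drift [IsProbabilityMeasure P] (h : IsPolledDM1 P p μ polled service T₀)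
    {D : ℝ} (hp0 : 0 < p) (hp1 : p ≤ 1) (hμ : 0 < μ) (hρ : p < μ * D) :
    ∀ᵐ ω ∂P, Tendsto (fun n => ∑ j ∈ Finset.range n,
      (service (j + 1) ω - ((skips polled j ω : ℝ) + 1) * D)) atTop atBot := by
  have s1 := strong_law_ae_real (μ := P) (fun j ω => service (j + 1) ω)
    (h.integrable_service hμ 1)
    (fun i j hij => h.indep_service.indepFun (fun h => hij (by simpa using h)))
    (fun i => ⟨(h.measurable_service _).aemeasurable, (h.measurable_service _).aemeasurable, by
      rw [h.law_service, h.law_service]⟩)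
  have hcast : Measurable fun k : ℕ => (k : ℝ) + 1 := measurable_from_top
  have s2 := strong_law_ae_real (μ := P) (fun j ω => (skips polled j ω : ℝ) + 1)
    (h.integrable_comp_skips hp0 hp1 (geometric_mean_succ hp0 hp1).1 0)
    (fun i j hij => by
      rcases lt_or_gt_of_ne hij with hlt | hlt
      · exact (h.indepFun_skips hp0 hp1 hlt).comp hcast hcast
      · exact ((h.indepFun_skips hp0 hp1 hlt).comp hcast hcast).symm)
    (fun i => IdentDistrib.comp (u := fun k : ℕ => (k : ℝ) + 1)
      ⟨(h.skips_measurable i).aemeasurable, (h.skips_measurable 0).aemeasurable, by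
        rw [h.map_skips hp0 hp1, h.map_skips hp0 hp1]⟩ hcast)
  rw [h.integral_service hμ] at s1
  rw [h.integral_comp_skips hp0 hp1 (fun k => (k : ℝ) + 1),
    (geometric_mean_succ hp0 hp1).2] at s2
  filter_upwards [s1, s2] with ω h1 h2
  have h3 := h1.sub (h2.mul_const D)
  have hneg : 1 / μ - 1 / p * D < 0 := by
    rw [sub_neg, one_div_mul_eq_div, div_lt_div_iff₀ hμ hp0]
    linarith
  -- The mean drift is negative, so the sums behave like a negative multiple of `n`.
  have h4 := h3.neg_mul_atTop hneg tendsto_natCast_atTop_atTop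
  refine h4.congr' ?_
  filter_upwards [eventually_ne_atTop 0] with n hn
  have : (n : ℝ) ≠ 0 := by exact_mod_cast hn
  rw [Finset.sum_sub_distrib, ← Finset.sum_mul]
  field_simp

/-- Two queues fed with the same updates never drift apart. -/
theorem ae_abs_sub_le [IsProbabilityMeasure P] {T₀' : Ω → ℝ}
    (h : IsPolledDM1 P p μ polled service T₀) (h' : IsPolledDM1 P p μ polled service T₀')
    (hp0 : 0 < p) (D : ℝ) :
    ∀ᵐ ω ∂P, ∀ n, |sysTime D polled service T₀ n ω - sysTime D polled service T₀' n ω| ≤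
      |T₀ ω - T₀' ω| := by
  filter_upwards [h.ae_sysTime_succ hp0 D, h'.ae_sysTime_succ hp0 D] with ω h1 h2 n
  induction n with
  | zero => rw [sysTime_zero, sysTime_zero]
  | succ n ih =>
    rw [h1, h2, add_sub_add_right_eq_sub]
    exact (abs_waitFun_sub_le D _ _ _).trans ih

/-- Two queues fed with the same updates eventually coincide. Until they do, the larger system time
has never been absorbed by an interarrival time, so it is the larger initial one plus the partial
sum of the drift; this would become negative. -/
theorem ae_eventually_eq [IsProbabilityMeasure P] {T₀' : Ω → ℝ}
    (h : IsPolledDM1 P p μ polled service T₀) (h' : IsPolledDM1 P p μ polled service T₀')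
    {D : ℝ} (hp0 : 0 < p) (hp1 : p ≤ 1) (hμ : 0 < μ) (hρ : p < μ * D) :
    ∀ᵐ ω ∂P, ∀ᶠ n in atTop,
      sysTime D polled service T₀ n ω = sysTime D polled service T₀' n ω := by
  filter_upwards [h.ae_sysTime_succ hp0 D, h'.ae_sysTime_succ hp0 D, h.ae_sysTime_nonneg hp0 D,
    h.ae_tendsto_drift hp0 hp1 hμ hρ] with ω h1 h2 h3 h4
  have key : ∀ n, sysTime D polled service T₀ n ω = sysTime D polled service T₀' n ω ∨
      max (sysTime D polled service T₀ n ω) (sysTime D polled service T₀' n ω) =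
        max (T₀ ω) (T₀' ω) + ∑ j ∈ Finset.range n,
          (service (j + 1) ω - ((skips polled j ω : ℝ) + 1) * D) := by
    intro n
    induction n with
    | zero => right; simp [sysTime_zero]
    | succ n ih =>
      rw [h1, h2, Finset.sum_range_succ, max_add_add_right]
      simp only [waitFun, add_left_inj]
      rcases ih with ih | ih
      · left; rw [ih]
      · rcases le_or_gt (max (sysTime D polled service T₀ n ω)
          (sysTime D polled service T₀' n ω)) (((skips polled n ω : ℝ) + 1) * D) with hle | hgt
        · left
          rw [max_eq_right, max_eq_right]
          · linarith [(le_max_right _ _).trans hle]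
          · linarith [(le_max_left _ _).trans hle]
        · right
          rw [← max_max_max_comm, max_self, max_sub_sub_right, max_eq_left (by linarith), ih]
          ring
  filter_upwards [h4.eventually_lt_atBot (-max (T₀ ω) (T₀' ω))] with n hn
  refine (key n).resolve_right fun hmax => ?_
  have := (h3 n).trans (le_max_left _ (sysTime D polled service T₀' n ω))
  linarith

/-- Functionals of the two system times become equal on average, under any integrable domination. -/
theorem tendsto_integral_sub [IsProbabilityMeasure P] {T₀' : Ω → ℝ}
    (h : IsPolledDM1 P p μ polled service T₀) (h' : IsPolledDM1 P p μ polled service T₀')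
    {D : ℝ} (hp0 : 0 < p) (hp1 : p ≤ 1) (hμ : 0 < μ) (hρ : p < μ * D) {F : ℝ → ℝ}
    (hF : Measurable F) {G : Ω → ℝ} (hG : Integrable G P)
    (hb : ∀ᵐ ω ∂P, ∀ n, |F (sysTime D polled service T₀ n ω) -
      F (sysTime D polled service T₀' n ω)| ≤ G ω) :
    Tendsto (fun n => ∫ ω, (F (sysTime D polled service T₀ n ω) -
      F (sysTime D polled service T₀' n ω)) ∂P) atTop (𝓝 0) := by
  have := tendsto_integral_of_dominated_convergence (μ := P) (f := fun _ => (0 : ℝ)) G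
    (F := fun n ω => F (sysTime D polled service T₀ n ω) - F (sysTime D polled service T₀' n ω))
    (fun n => ((hF.comp (h.sysTime_measurable D n)).sub
      (hF.comp (h'.sysTime_measurable D n))).aestronglyMeasurable) hG
    (fun n => hb.mono fun ω hω => hω n) (by
      filter_upwards [h.ae_eventually_eq h' hp0 hp1 hμ hρ] with ω hω
      refine tendsto_const_nhds.congr' ?_
      filter_upwards [hω] with n hn
      rw [hn, sub_self])
  simpa using this

end IsPolledDM1

/-! ### Convergence to the steady state -/

theorem genIndex_comp {Ω' : Type*} (polled : ℕ → Ω → Bool) (f : Ω' → Ω) (ω : Ω') (i : ℕ) :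
    genIndex (fun n z => polled n (f z)) ω i = genIndex polled (f ω) i := by
  induction i with
  | zero => rfl
  | succ i ih => rw [genIndex, genIndex, ih]

theorem sysTime_comp {Ω' : Type*} (D : ℝ) (polled : ℕ → Ω → Bool) (service : ℕ → Ω → ℝ)
    (T₀ : Ω → ℝ) (f : Ω' → Ω) (i : ℕ) :
    sysTime D (fun n z => polled n (f z)) (fun n z => service n (f z)) (fun z => T₀ (f z)) i =
      fun ω => sysTime D polled service T₀ i (f ω) := by
  funext ω
  have hdep : ∀ i, depTime D (fun n z => polled n (f z)) (fun n z => service n (f z))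
      (fun z => T₀ (f z)) i ω = depTime D polled service T₀ i (f ω) := by
    intro i
    induction i with
    | zero => rfl
    | succ i ih => rw [depTime, depTime, ih, genTime, genTime, genIndex_comp polled f]
  rw [sysTime, sysTime, hdep, genTime, genTime, genIndex_comp polled f]

/-- The mean of the number of hops between two updates times the waiting time of the second one,
given the system time `x` of the first one. It is the only part of the mean area that depends on
the state of the queue. -/
noncomputable def meanWait (D : ℝ) {p : ℝ} (hp0 : 0 < p) (hp1 : p ≤ 1) (x : ℝ) : ℝ :=
  ∫ k : ℕ, ((k : ℝ) + 1) * waitFun D (x, k) ∂geometricMeasure (successProb hp0 hp1)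

theorem measurable_meanWait (D : ℝ) {p : ℝ} (hp0 : 0 < p) (hp1 : p ≤ 1) :
    Measurable (meanWait D hp0 hp1) :=
  (StronglyMeasurable.integral_prod_right' (f := fun z : ℝ × ℕ => ((z.2 : ℝ) + 1) * waitFun D z)
    (measurable_succ_snd.mul (measurable_waitFun D)).stronglyMeasurable).measurable

theorem abs_meanWait_sub_le {D : ℝ} (hD : 0 < D) {p : ℝ} (hp0 : 0 < p) (hp1 : p ≤ 1) (x y : ℝ) :
    |meanWait D hp0 hp1 x - meanWait D hp0 hp1 y| ≤ 1 / p * |x - y| := by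
  obtain ⟨hi, hint⟩ := geometric_mean_succ hp0 hp1
  have hmeas : ∀ x : ℝ, AEStronglyMeasurable
      (fun k : ℕ => ((k : ℝ) + 1) * waitFun D (x, k)) (geometricMeasure (successProb hp0 hp1)) :=
    fun x => measurable_from_top.aestronglyMeasurable
  have hx : ∀ x : ℝ, Integrable (fun k : ℕ => ((k : ℝ) + 1) * waitFun D (x, k))
      (geometricMeasure (successProb hp0 hp1)) := by
    intro x
    refine (hi.mul_const |x|).mono' (hmeas x) (ae_of_all _ fun k => ?_)
    have h1 : (0 : ℝ) ≤ (k : ℝ) + 1 := by positivity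
    rw [Real.norm_of_nonneg (mul_nonneg h1 (waitFun_nonneg D _))]
    exact mul_le_mul_of_nonneg_left (waitFun_le_abs hD (x, k)) h1
  rw [meanWait, meanWait, ← integral_sub (hx x) (hx y), ← hint, ← integral_mul_const]
  rw [← Real.norm_eq_abs]
  refine norm_integral_le_of_norm_le (hi.mul_const _) (ae_of_all _ fun k => ?_)
  have h1 : (0 : ℝ) ≤ (k : ℝ) + 1 := by positivity
  rw [← mul_sub, norm_mul, Real.norm_of_nonneg h1]
  exact mul_le_mul_of_nonneg_left (abs_waitFun_sub_le D x y k) h1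

theorem integral_meanWait {D : ℝ} (hD : 0 < D) {p : ℝ} (hp0 : 0 < p) (hp1 : p ≤ 1)
    {ν : Measure ℝ} [IsProbabilityMeasure ν] (hν : Integrable (fun x => x) ν) :
    Integrable (meanWait D hp0 hp1) ν ∧
      ∫ z : ℝ × ℕ, ((z.2 : ℝ) + 1) * waitFun D z
        ∂(ν.prod (geometricMeasure (successProb hp0 hp1))) = ∫ x, meanWait D hp0 hp1 x ∂ν :=
  have h := integrable_succ_mul_waitFun hp0 hp1 hD hν
  ⟨h.integral_prod_left, integral_prod _ h⟩

namespace IsPolledDM1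

variable [mΩ : MeasurableSpace Ω] {P : Measure Ω} {p μ : ℝ} {polled : ℕ → Ω → Bool}
  {service : ℕ → Ω → ℝ} {T₀ : Ω → ℝ}

theorem map_sysTime_of_init [IsProbabilityMeasure P]
    (h : IsPolledDM1 P p μ polled service T₀) {D β : ℝ} (hD : 0 < D) (hp0 : 0 < p) (hp1 : p ≤ 1)
    (hμ : 0 < μ) (hβ : β < 1) (hroot : IsRoot p μ D β)
    (h0 : P.map T₀ = expMeasure (μ * (1 - β))) (i : ℕ) :
    P.map (sysTime D polled service T₀ i) = expMeasure (μ * (1 - β)) := by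
  induction i with
  | zero => rwa [sysTime_zero]
  | succ i ih => exact h.map_sysTime_succ hD hp0 hp1 hμ hβ hroot ih

/-- Whatever the law of the initial system time, the law of the system times approaches the
exponential law of rate `μ (1 - β)`, tested against any `F` for which the coupling with a queue
started from that law is dominated. -/
theorem tendsto_integral_comp_sysTime [IsProbabilityMeasure P]
    (h : IsPolledDM1 P p μ polled service T₀) {D β : ℝ} (hD : 0 < D) (hp0 : 0 < p) (hp1 : p ≤ 1)
    (hμ : 0 < μ) (hρ : p < μ * D) (hβ : β < 1) (hroot : IsRoot p μ D β) {F : ℝ → ℝ}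
    (hF : Measurable F) (hFi : ∀ n, Integrable (fun ω => F (sysTime D polled service T₀ n ω)) P)
    (hFe : Integrable F (expMeasure (μ * (1 - β)))) {G : Ω × ℝ → ℝ}
    (hG : Integrable G (P.prod (expMeasure (μ * (1 - β)))))
    (hb : ∀ z x y, |x - y| ≤ |T₀ z.1 - z.2| → |F x - F y| ≤ G z) :
    Tendsto (fun n => ∫ ω, F (sysTime D polled service T₀ n ω) ∂P) atTop
      (𝓝 (∫ x, F x ∂expMeasure (μ * (1 - β)))) := by
  have hr : 0 < μ * (1 - β) := mul_pos hμ (sub_pos.2 hβ)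
  have := isProbabilityMeasure_expMeasure hr
  set π := expMeasure (μ * (1 - β))
  have h1 := h.prod_fst π
  have h2 := h.prod_snd (ν := π) (ae_nonneg_expMeasure _)
  have hlaw : ∀ i, (P.prod π).map (sysTime D (fun n z => polled n z.1)
      (fun n z => service n z.1) (fun z => z.2) i) = π :=
    h2.map_sysTime_of_init hD hp0 hp1 hμ hβ hroot
    (measurePreserving_snd (μ := P) (ν := π)).map_eq
  have key := h1.tendsto_integral_sub h2 hp0 hp1 hμ hρ hF hG (by
    filter_upwards [h1.ae_abs_sub_le h2 hp0 D] with z hz n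
    exact hb z _ _ (hz n))
  have hfst : ∀ n, Integrable (fun z : Ω × ℝ => F (sysTime D polled service T₀ n z.1))
      (P.prod π) := fun n => (hFi n).comp_fst π
  have hsnd : ∀ n, Integrable (fun z : Ω × ℝ => F (sysTime D (fun n z => polled n z.1)
      (fun n z => service n z.1) (fun z => z.2) n z)) (P.prod π) := fun n => by
    have := hFe
    rw [← hlaw n] at this
    exact this.comp_measurable (h2.sysTime_measurable D n)
  have heq : ∀ n, ∫ z, (F (sysTime D (fun n z => polled n z.1) (fun n z => service n z.1)
      (fun z => T₀ z.1) n z) - F (sysTime D (fun n z => polled n z.1)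
      (fun n z => service n z.1) (fun z => z.2) n z)) ∂(P.prod π) =
      ∫ ω, F (sysTime D polled service T₀ n ω) ∂P - ∫ x, F x ∂π := by
    intro n
    rw [sysTime_comp D polled service T₀ Prod.fst n, integral_sub (hfst n) (hsnd n),
      integral_fun_fst (fun ω => F (sysTime D polled service T₀ n ω)), probReal_univ, one_smul,
      ← integral_map (h2.sysTime_measurable D n).aemeasurable hF.aestronglyMeasurable, hlaw]
  simp_rw [heq] at key
  simpa using key.add_const (∫ x, F x ∂π)

/-- The exponential law of rate `μ (1 - β)` is the only steady state. -/
theorem map_sysTime_of_isSteady [IsProbabilityMeasure P]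
    (h : IsPolledDM1 P p μ polled service T₀) {D β : ℝ} (hD : 0 < D) (hp0 : 0 < p) (hp1 : p ≤ 1)
    (hμ : 0 < μ) (hρ : p < μ * D) (hβ : β < 1) (hroot : IsRoot p μ D β)
    (hst : IsSteady P D polled service T₀) (i : ℕ) :
    P.map (sysTime D polled service T₀ i) = expMeasure (μ * (1 - β)) := by
  have hr : 0 < μ * (1 - β) := mul_pos hμ (sub_pos.2 hβ)
  have := isProbabilityMeasure_expMeasure hr
  rw [(hst i).map_eq]
  have : IsProbabilityMeasure (P.map (sysTime D polled service T₀ 0)) :=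
    Measure.isProbabilityMeasure_map (h.sysTime_measurable D 0).aemeasurable
  refine ext_of_forall_integral_eq_of_IsFiniteMeasure fun F => ?_
  have hF : Measurable F := F.continuous.measurable
  have hlim := h.tendsto_integral_comp_sysTime hD hp0 hp1 hμ hρ hβ hroot hF
    (fun n => Integrable.of_bound (hF.comp (h.sysTime_measurable D n)).aestronglyMeasurable ‖F‖
      (ae_of_all _ fun ω => F.norm_coe_le_norm _))
    (F.integrable _) (G := fun _ => 2 * ‖F‖) (integrable_const _)
    (fun _ x y _ => by
      rw [← Real.dist_eq]; exact F.dist_le_two_norm x y)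
  have hconst : ∀ n, ∫ ω, F (sysTime D polled service T₀ n ω) ∂P =
      ∫ x, F x ∂P.map (sysTime D polled service T₀ 0) := by
    intro n
    rw [← (hst n).map_eq, integral_map (h.sysTime_measurable D n).aemeasurable
      hF.aestronglyMeasurable]
  simp_rw [hconst] at hlim
  exact tendsto_nhds_unique tendsto_const_nhds hlim

end IsPolledDM1

end AgeOfPositioning

theorem theorem3 {Ω : Type*} [MeasurableSpace Ω] (P : MeasureTheory.Measure Ω)
    [MeasureTheory.IsProbabilityMeasure P] (v D p μ : ℝ)
    (hD : 0 < D) (hp0 : 0 < p) (hp1 : p ≤ 1) (hμ : 0 < μ)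
    (hρ : p * (1 / D) / μ < 1)
    (polled : ℕ → Ω → Bool) (service : ℕ → Ω → ℝ) (T₀ : Ω → ℝ)
    (hQ : AgeOfPositioning.IsPolledDM1 P p μ polled service T₀) :
    (∃! β : ℝ, β ∈ Set.Ioo (0 : ℝ) 1 ∧ AgeOfPositioning.IsRoot p μ D β) ∧
    ∀ β ∈ Set.Ioo (0 : ℝ) 1, AgeOfPositioning.IsRoot p μ D β →
      (AgeOfPositioning.IsSteady P D polled service T₀ →
        ∀ i, Integrable (AgeOfPositioning.areaQ v D polled service T₀ i) P ∧
          ∫ ω, AgeOfPositioning.areaQ v D polled service T₀ i ω ∂P =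
            AgeOfPositioning.meanQ v p μ D β) ∧
      (Integrable T₀ P →
        (∀ i, Integrable (AgeOfPositioning.areaQ v D polled service T₀ i) P) ∧
        Tendsto (fun i => ∫ ω, AgeOfPositioning.areaQ v D polled service T₀ i ω ∂P) atTop
          (𝓝 (AgeOfPositioning.meanQ v p μ D β))) := by
  open AgeOfPositioning in
  have hρ' : p < μ * D := by
    rw [div_lt_one hμ, mul_one_div, div_lt_iff₀ hD] at hρ
    exact hρ
  refine ⟨existsUnique_isRoot hD hp0 hp1 hμ hρ', fun β hβ hroot => ?_⟩
  have hr : 0 < μ * (1 - β) := mul_pos hμ (sub_pos.2 hβ.2)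
  have := isProbabilityMeasure_expMeasure hr
  have hid := integrable_id_expMeasure hr
  have hmean := integral_succ_mul_waitFun hD hp0 hp1 hμ hβ.2
  refine ⟨fun hst i => ?_, fun hT => ?_⟩
  · have hlaw := hQ.map_sysTime_of_isSteady hD hp0 hp1 hμ hρ' hβ.2 hroot hst i
    have hi : Integrable (sysTime D polled service T₀ i) P := by
      rw [← hlaw] at hid
      exact hid.comp_measurable (hQ.sysTime_measurable D i)
    have hQi := hQ.integrable_areaQ_and_integral hD hp0 hp1 hμ v hi
    rw [hlaw, hmean] at hQi
    exact hQi
  · have hTi := fun i => hQ.integrable_sysTime hD hp0 hμ hT i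
    have hQi := fun i => hQ.integrable_areaQ_and_integral hD hp0 hp1 hμ v (hTi i)
    refine ⟨fun i => (hQi i).1, ?_⟩
    simp_rw [fun i => (hQi i).2]
    refine Tendsto.const_add _ (Tendsto.const_mul _ (Tendsto.add_const _ ?_))
    obtain ⟨hπi, hπ⟩ := integral_meanWait hD hp0 hp1 hid
    rw [← hmean, hπ]
    have hm := measurable_meanWait D hp0 hp1
    have hν : ∀ i, IsProbabilityMeasure (P.map (sysTime D polled service T₀ i)) := fun i =>
      Measure.isProbabilityMeasure_map (hQ.sysTime_measurable D i).aemeasurable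
    have hνi := fun i => integral_meanWait hD hp0 hp1
      (ν := P.map (sysTime D polled service T₀ i)) ((integrable_map_measure
        measurable_id.aestronglyMeasurable (hQ.sysTime_measurable D i).aemeasurable).2 (hTi i))
    have heq := fun i => (hνi i).2.trans (integral_map
      (hQ.sysTime_measurable D i).aemeasurable hm.aestronglyMeasurable)
    simp_rw [heq]
    refine hQ.tendsto_integral_comp_sysTime hD hp0 hp1 hμ hρ' hβ.2 hroot hm
      (fun n => (hνi n).1.comp_measurable (hQ.sysTime_measurable D n)) hπi
      (G := fun z => 1 / p * |T₀ z.1 - z.2|)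
      (((hT.comp_fst _).sub (hid.comp_snd P)).abs.const_mul _) fun z x y hxy => ?_
    exact (abs_meanWait_sub_le hD hp0 hp1 x y).trans
      (mul_le_mul_of_nonneg_left hxy (by positivity))
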